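/- **Setting.** A multi-source multicast instance with $k$ sessions consists of a finite undirected graph $G=(V,E)$ with edge capacities $c_e\ge 0$ and, for each $i\in\{1,\dots,k\}$, a source $s_i\in V$, a set of sinks $R_i\subseteq V$ and a demand $d_i\ge 0$. It is called *unit* if $G$ is connected, $c_e=1$ for all $e$, $d_i=1$ for all $i$, and every $R_i$ is non-empty and does not contain $s_i$. A *network coding solution* consists of finite message sets $M_i$ with independent random messages $m_i\in M_i$ and, for each of the two directions $\vec e$ of each edge and each time $t=0,1,2,\dots$, a symbol $X_{\vec e,t}$ that is a function of $(m_1,\dots,m_k)$, such that (causality) for $\vec e=(u,v)$ the symbol $X_{\vec e,t}$ is a function of the messages $m_i$ with $s_i=u$ and of all symbols that reached $u$ at times before $t$, and (correctness) for each $v\in R_i$ the message $m_i$ is a function of the messages $m_j$ with $s_j=v$ and of all symbols that ever reach $v$. The *throughput* of the instance is the supremum of all $r\ge0$ for which there are a network coding solution and a scale $c^*>0$ with $H(m_i)\ge r\,d_i\,c^*$ for all $i$, and $H\big((X_{\vec e,t})_t\big)+H\big((X_{\overleftarrow e,t})_t\big)\le c_e\,c^*$ for all $e\in E$, where $H$ is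 Shannon entropy. The *multi-Steiner-tree packing number* is the supremum of all $\tau\ge0$ for which there are weights $x_{i,T}\ge 0$, where $T$ ranges over the subtrees of $G$ containing $R_i\cup\{s_i\}$, with $\sum_T x_{i,T}\ge\tau d_i$ for all $i$ and $\sum_{i}\sum_{T\ni e}x_{i,T}\le c_e$ for all $e\in E$. The *coding gap* of the instance is its throughput divided by its multi-Steiner-tree packing number. **Theorem.** 1. There is a constant $c>0$ such that for every sufficiently large $k$ there is a unit multi-source multicast instance with $k$ sessions whose coding gap is at least $c\log k$. 2. There is a constant $c>0$ such that for every sufficiently large $n$ there is a unit multi-source multicast instance on a graph with $n$ vertices whose coding gap is at least $2^{\,c\sqrt{\log\log n/\log\log\log n}}$. -/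

import Mathlib

open scoped NNReal ENNReal

namespace NetworkCoding

/-- A multi-source multicast instance with `k` sessions on the vertex set `V`: an undirected graph,
a capacity for every edge (the values of `cap` off the edge set play no role), and, for each
session, a source, a set of sinks and a demand. -/
structure MulticastInstance (V : Type) (k : ℕ) where
  graph : SimpleGraph V
  cap : Sym2 V → ℝ≥0
  source : Fin k → V
  sinks : Fin k → Set V
  demand : Fin k → ℝ≥0

open Classical in
/-- The Shannon entropy (in nats) of a random variable `X : Ω → Γ` on a finite probability space
`Ω` whose point masses are given by `P`. -/
noncomputable def entropy {Ω Γ : Type} [Fintype Ω] (P : Ω → ℝ) (X : Ω → Γ) : ℝ :=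
  ∑ γ ∈ Finset.univ.image X, Real.negMulLog (∑ ω with X ω = γ, P ω)

namespace MulticastInstance

variable {V : Type} {k : ℕ}

/-- A network coding solution over time: every edge is a pair of opposite directed edges (darts),
and every dart `d` transmits a symbol `symbol d t` at every time step `t = 0, 1, 2, …`. Vertices
have unlimited memory: what is sent from a vertex at time `t` may depend on all messages
originating at that vertex and on everything that it received strictly before time `t`. -/
structure Solution (I : MulticastInstance V k) where
  /-- The message set of each session. -/
  Msg : Fin k → Type
  [fintypeMsg : ∀ i, Fintype (Msg i)]
  /-- The distribution of the message of each session; distinct sessions are independent. -/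
  dist : ∀ i, Msg i → ℝ
  dist_nonneg : ∀ i a, 0 ≤ dist i a
  dist_sum : ∀ i, ∑ a, dist i a = 1
  /-- The alphabet of each dart at each time step. -/
  Alphabet : I.graph.Dart → ℕ → Type
  /-- The transmitted symbol, as a function of the tuple of all messages. -/
  symbol : ∀ (d : I.graph.Dart) (t : ℕ), (∀ i, Msg i) → Alphabet d t
  /-- Causality: a transmitted symbol is a function of what its tail vertex knows at that time. -/
  causality : ∀ (d : I.graph.Dart) (t : ℕ) (m m' : ∀ i, Msg i),
    (∀ i, I.source i = d.fst → m i = m' i) →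
    (∀ d' : I.graph.Dart, d'.snd = d.fst → ∀ s < t, symbol d' s m = symbol d' s m') →
    symbol d t m = symbol d t m'
  /-- Correctness: the message of a session is a function of what each of its sinks learns. -/
  correctness : ∀ (i : Fin k), ∀ v ∈ I.sinks i, ∀ m m' : (∀ i, Msg i),
    (∀ j, I.source j = v → m j = m' j) →
    (∀ d : I.graph.Dart, d.snd = v → ∀ s, symbol d s m = symbol d s m') →
    m i = m' i

namespace Solution

variable {I : MulticastInstance V k}

attribute [instance] Solution.fintypeMsg

/-- The probability of a tuple of messages, drawn independently across the sessions. -/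
def prob (S : I.Solution) (m : ∀ i, S.Msg i) : ℝ := ∏ i, S.dist i (m i)

/-- The entropy of the message of session `i`. -/
noncomputable def sourceEntropy (S : I.Solution) (i : Fin k) : ℝ := entropy (S.dist i) id

/-- The entropy of everything sent along the dart `d` over all time steps. -/
noncomputable def dartEntropy (S : I.Solution) (d : I.graph.Dart) : ℝ :=
  entropy S.prob fun m (t : ℕ) => S.symbol d t m

/-- The solution `S` has rate `r` at the scale `scale`. -/
def HasRate (S : I.Solution) (r : ℝ≥0) (scale : ℝ) : Prop :=
  (∀ i, (r : ℝ) * I.demand i * scale ≤ S.sourceEntropy i) ∧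
  ∀ d : I.graph.Dart, S.dartEntropy d + S.dartEntropy d.symm ≤ I.cap d.edge * scale

end Solution

/-- The network coding throughput: the supremum of all rates `r` that some network coding solution
(with some message distribution) has at some positive scale. -/
noncomputable def throughput (I : MulticastInstance V k) : ℝ≥0∞ :=
  ⨆ r ∈ {r : ℝ≥0 | ∃ S : I.Solution, ∃ scale : ℝ, 0 < scale ∧ S.HasRate r scale}, (r : ℝ≥0∞)

/-- A Steiner tree for session `i`: a subtree of the graph that contains the source and all sinks
of that session. -/
def IsSteinerTree (I : MulticastInstance V k) (i : Fin k) (T : I.graph.Subgraph) : Prop :=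
  T.coe.IsTree ∧ insert (I.source i) (I.sinks i) ⊆ T.verts

/-- The finite set of all Steiner trees for session `i`. -/
noncomputable def steinerTrees [Finite V] (I : MulticastInstance V k) (i : Fin k) :
    Finset I.graph.Subgraph :=
  (Set.toFinite {T | I.IsSteinerTree i T}).toFinset

open Classical in
/-- `x` is a fractional packing of Steiner trees, of total weight at least `τ * d i` for each
session `i`, which jointly respects the edge capacities. -/
def IsSteinerPacking [Finite V] (I : MulticastInstance V k) (τ : ℝ≥0)
    (x : Fin k → I.graph.Subgraph → ℝ≥0) : Prop :=
  (∀ i, τ * I.demand i ≤ ∑ T ∈ I.steinerTrees i, x i T) ∧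
  ∀ e ∈ I.graph.edgeSet, ∑ i, ∑ T ∈ I.steinerTrees i with e ∈ T.edgeSet, x i T ≤ I.cap e

/-- The multi-Steiner-tree packing number. -/
noncomputable def steinerPackingNumber [Finite V] (I : MulticastInstance V k) : ℝ≥0∞ :=
  ⨆ τ ∈ {τ : ℝ≥0 | ∃ x, I.IsSteinerPacking τ x}, (τ : ℝ≥0∞)

/-- The coding gap. -/
noncomputable def codingGap [Finite V] (I : MulticastInstance V k) : ℝ≥0∞ :=
  I.throughput / I.steinerPackingNumber

/-- The graph is connected, all capacities and demands are one, and every session has a sink, each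
sink being different from the source. -/
structure IsUnitInstance (I : MulticastInstance V k) : Prop where
  connected : I.graph.Connected
  cap_eq_one : ∀ e ∈ I.graph.edgeSet, I.cap e = 1
  demand_eq_one : ∀ i, I.demand i = 1
  sinks_nonempty : ∀ i, (I.sinks i).Nonempty
  source_notMem_sinks : ∀ i, I.source i ∉ I.sinks i

end MulticastInstance

end NetworkCoding

/-!
The instances come from codes with local decoding. Suppose that `k` messages over a finite alphabet
are encoded by one symbol for each element of a finite abelian group `W`, and that for every `w` the
message `i` is a function of the `q` symbols at `w + b i j`, `j < q` (`QueryCode`).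

Take a long path with vertices `0, 1, …`, and `k` stars with `q` legs that end at distinct path
vertices, and give the leg `(i, j)` the label `b i j`. The instance is the covering graph of this
labelled graph with group `W`, together with the sources, which are joined to the roots of all
`|W|` paths. The sinks of session `i` are all lifts of the centre of star `i`.

* *Coding is cheap.* The path with index `w` carries the code symbol at `w`, so that each sink can
  decode from its `q` legs, and each edge carries at most one symbol
  (`one_le_throughput_coverInstance`).
* *Routing is expensive.* As long as balls of radius `2 ρ + 1` in the base graph have at most `k`
  elements, the legs can be chosen greedily in such a way that closed walks of length at most `2 ρ`
  have label zero (`baseGraph.exists_legs`). Such walks lift to closed walks, so any two sinks of a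
  session have distance more than `2 ρ`, and the balls of radius `ρ` around them are disjoint. A
  Steiner tree leaves each of these balls and hence has at least `ρ |W|` edges
  (`exists_edges_of_isSteinerTree`). As the graph has `O(q k |W|)` edges apart from those at the
  sources, the packing number is `O(q / ρ)`.

This gives a gap of `ρ / (4 q)`, with `ρ` of the order `log k / log q`
(`exists_instance_of_queryCode`).

For the first claim, the Hadamard code has `q = 2`, on the group `W = (ZMod 2) ^ k`. For the second
claim the group has to be much smaller. The matching vector codes (`exists_matchingVectorCode`),
based on the low degree polynomials of Barrington, Beigel and Rudich modulo several primes and the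
set systems of Grolmusz, have `q = 2 ^ t` where `t` is the number of primes. For `256 ^ t` message
bits, i.e. `k = 2 ^ 256 ^ t`, the resulting graphs have `exp (exp (O (t ^ 2 log t)))` vertices, and
the gap is `2 ^ t`. Here it matters that the `t` primes can be chosen of size `O(t log t)`.
-/

namespace NetworkCoding

/-! ### Labelled walks and the greedy choice of the legs -/

section LabelledWalks

variable {X A : Type*} [AddCommGroup A]

/-- `LabelledWalk E n u v a`: there is a walk of length `n` from `u` to `v` along edges of the
labelled graph `E` (where `E u v c` is a dart from `u` to `v` with label, or voltage, `c`) whose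
labels add up to `a`. -/
inductive LabelledWalk (E : X → X → A → Prop) : ℕ → X → X → A → Prop
  | nil (u : X) : LabelledWalk E 0 u u 0
  | cons {u v w : X} {c a : A} {n : ℕ} :
      E u v c → LabelledWalk E n v w a → LabelledWalk E (n + 1) u w (c + a)

namespace LabelledWalk

variable {E E' : X → X → A → Prop} {u v w s t : X} {a b : A} {n m R : ℕ}

lemma append (p : LabelledWalk E n u v a) (q : LabelledWalk E m v w b) :
    LabelledWalk E (n + m) u w (a + b) := by
  induction p with
  | nil u => simpa using q
  | @cons _ _ _ c a n e _ ih =>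
    have := cons e (ih q)
    rwa [← add_assoc, Nat.add_right_comm] at this

lemma snoc (p : LabelledWalk E n u v a) (e : E v w b) : LabelledWalk E (n + 1) u w (a + b) := by
  simpa using p.append (cons e (nil w))

lemma reverse (hE : ∀ u v c, E u v c → E v u (-c)) (p : LabelledWalk E n u v a) :
    LabelledWalk E n v u (-a) := by
  induction p with
  | nil u => simpa using nil (E := E) u
  | @cons _ _ _ c a n e _ ih =>
    have := ih.snoc (hE _ _ _ e)
    rwa [← neg_add_rev] at this

/-- A walk in a graph with one additional edge `s — t` either can be replaced by a walk of the
original graph that is not longer and has the same label, or by one that crosses the additional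
edge exactly once, provided that `s` and `t` are far apart in the original graph. -/
lemma of_add_edge (hE : ∀ u v c, E u v c → E v u (-c))
    (hE' : ∀ u v c, E' u v c → E u v c ∨ (u = s ∧ v = t ∧ c = b) ∨ (u = t ∧ v = s ∧ c = -b))
    (hclosed : ∀ u n a, LabelledWalk E n u u a → n < R → a = 0)
    (hfar : ∀ n a, LabelledWalk E n s t a → R ≤ n)
    (p : LabelledWalk E' n u v a) (hn : n < R) :
    (∃ n' ≤ n, LabelledWalk E n' u v a) ∨
    (∃ n₁ n₂ a₁ a₂, n₁ + n₂ + 1 ≤ n ∧ LabelledWalk E n₁ u s a₁ ∧ LabelledWalk E n₂ t v a₂ ∧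
      a = a₁ + b + a₂) ∨
    (∃ n₁ n₂ a₁ a₂, n₁ + n₂ + 1 ≤ n ∧ LabelledWalk E n₁ u t a₁ ∧ LabelledWalk E n₂ s v a₂ ∧
      a = a₁ - b + a₂) := by
  have hfar' : ∀ n a, LabelledWalk E n t s a → R ≤ n := fun n a q ↦ hfar n _ (q.reverse hE)
  induction p with
  | nil u => exact .inl ⟨0, le_rfl, nil u⟩
  | @cons u v w c a n e _ ih =>
    rcases hE' _ _ _ e with e | ⟨rfl, rfl, rfl⟩ | ⟨rfl, rfl, rfl⟩
    · rcases ih (by omega) with ⟨n', h, q⟩ | ⟨n₁, n₂, a₁, a₂, h, q₁, q₂, rfl⟩ |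
        ⟨n₁, n₂, a₁, a₂, h, q₁, q₂, rfl⟩
      · exact .inl ⟨n' + 1, by omega, cons e q⟩
      · exact .inr (.inl ⟨n₁ + 1, n₂, c + a₁, a₂, by omega, cons e q₁, q₂, by abel⟩)
      · exact .inr (.inr ⟨n₁ + 1, n₂, c + a₁, a₂, by omega, cons e q₁, q₂, by abel⟩)
    · rcases ih (by omega) with ⟨n', h, q⟩ | ⟨n₁, n₂, a₁, a₂, h, q₁, q₂, rfl⟩ |
        ⟨n₁, n₂, a₁, a₂, h, q₁, q₂, rfl⟩
      · exact .inr (.inl ⟨0, n', 0, a, by omega, nil _, q, by abel⟩)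
      · have := hfar' _ _ q₁
        omega
      · have := hclosed _ _ _ q₁ (by omega)
        subst this
        exact .inl ⟨n₂, by omega, by simpa using q₂⟩
    · rcases ih (by omega) with ⟨n', h, q⟩ | ⟨n₁, n₂, a₁, a₂, h, q₁, q₂, rfl⟩ |
        ⟨n₁, n₂, a₁, a₂, h, q₁, q₂, rfl⟩
      · exact .inr (.inr ⟨0, n', 0, a, by omega, nil _, q, by abel⟩)
      · have := hclosed _ _ _ q₁ (by omega)
        subst this
        exact .inl ⟨n₂, by omega, by simpa using q₂⟩
      · have := hfar _ _ q₁
        omega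

/-- Balls of radius `R` in a graph of maximum degree less than `D` have at most `D ^ R` elements. -/
lemma exists_ball [DecidableEq X] {D : ℕ} (nb : X → Finset X) (hcard : ∀ u, (nb u).card + 1 ≤ D)
    (hnb : ∀ u v c, E u v c → v ∈ nb u) (u : X) (R : ℕ) :
    ∃ B : Finset X, B.card ≤ D ^ R ∧ ∀ n v a, LabelledWalk E n u v a → n ≤ R → v ∈ B := by
  induction R generalizing u with
  | zero =>
    refine ⟨{u}, by simp, fun n v a p hn ↦ ?_⟩
    cases p with
    | nil => simp
    | cons => omega
  | succ R ih =>
    choose B hB hmem using ih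
    refine ⟨(insert u (nb u)).biUnion B, ?_, fun n v a p hn ↦ ?_⟩
    · calc _ ≤ (insert u (nb u)).card * D ^ R := Finset.card_biUnion_le_card_mul _ _ _ fun v _ ↦ hB v
        _ ≤ D * D ^ R := by gcongr; exact (Finset.card_insert_le _ _).trans (hcard u)
        _ = D ^ (R + 1) := by ring
    · cases p with
      | nil => exact Finset.mem_biUnion.2 ⟨u, by simp, hmem u 0 u 0 (nil u) (by omega)⟩
      | @cons _ v' _ c a' n e q =>
        exact Finset.mem_biUnion.2 ⟨v', by simp [hnb _ _ _ e], hmem v' n v a' q (by omega)⟩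

end LabelledWalk

/-- The labelled base graph: a path on the vertices `inl 0, inl 1, …` whose edges have label `0`,
and for every pair `(i, j) ∈ S` an edge from the star centre `inr i` to the path vertex `x (i, j)`
with label `b i j`. -/
def baseGraph {ι κ : Type*} (b : ι → κ → A) (S : Set (ι × κ)) (x : ι × κ → ℕ) :
    ℕ ⊕ ι → ℕ ⊕ ι → A → Prop
  | .inl p, .inl p', c => c = 0 ∧ (p' = p + 1 ∨ p = p' + 1)
  | .inr i, .inl p, c => ∃ j, (i, j) ∈ S ∧ x (i, j) = p ∧ c = b i j
  | .inl p, .inr i, c => ∃ j, (i, j) ∈ S ∧ x (i, j) = p ∧ c = -b i j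
  | .inr _, .inr _, _ => False

namespace baseGraph

variable {ι κ : Type*} {b : ι → κ → A} {S : Set (ι × κ)} {x : ι × κ → ℕ}

lemma symm (u v : ℕ ⊕ ι) (c : A) (h : baseGraph b S x u v c) : baseGraph b S x v u (-c) := by
  rcases u with p | i <;> rcases v with p' | i' <;> simp only [baseGraph] at h ⊢
  · exact ⟨by simp [h.1], h.2.symm⟩
  · obtain ⟨j, h1, h2, h3⟩ := h
    exact ⟨j, h1, h2, by simp [h3]⟩
  · obtain ⟨j, h1, h2, h3⟩ := h
    exact ⟨j, h1, h2, by simp [h3]⟩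

/-- As the legs end at distinct path vertices, a path vertex has degree at most three and a star
centre has degree at most `q`. -/
lemma exists_ball [Fintype κ] [DecidableEq ι] (hx : Set.InjOn x S) (u : ℕ ⊕ ι) (R : ℕ) :
    ∃ B : Finset (ℕ ⊕ ι), B.card ≤ (Fintype.card κ + 4) ^ R ∧
      ∀ n v a, LabelledWalk (baseGraph b S x) n u v a → n ≤ R → v ∈ B := by
  classical
  have hstar : ∀ p : ℕ, ∃ T : Finset ι, T.card ≤ 1 ∧ ∀ i j, (i, j) ∈ S → x (i, j) = p → i ∈ T := by
    intro p
    by_cases h : ∃ e ∈ S, x e = p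
    · obtain ⟨e, he, rfl⟩ := h
      refine ⟨{e.1}, by simp, fun i j hij hxe ↦ ?_⟩
      rw [← hx hij he hxe]
      simp
    · exact ⟨∅, by simp, fun i j hij hxe ↦ (h ⟨_, hij, hxe⟩).elim⟩
  choose T hT hTmem using hstar
  let nb : ℕ ⊕ ι → Finset (ℕ ⊕ ι) := fun
    | .inl p => {.inl (p + 1), .inl (p - 1)} ∪ (T p).image .inr
    | .inr i => (Finset.univ : Finset κ).image fun j ↦ .inl (x (i, j))
  refine LabelledWalk.exists_ball nb (fun u ↦ ?_) (fun u v c h ↦ ?_) u R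
  · rcases u with p | i
    · have h1 : ({.inl (p + 1), .inl (p - 1)} : Finset (ℕ ⊕ ι)).card ≤ 2 := Finset.card_le_two
      have h2 : ((T p).image (.inr : ι → ℕ ⊕ ι)).card ≤ 1 := Finset.card_image_le.trans (hT p)
      have h3 := Finset.card_union_le ({.inl (p + 1), .inl (p - 1)} : Finset (ℕ ⊕ ι))
        ((T p).image .inr)
      simp only [nb]
      omega
    · have : (nb (.inr i)).card ≤ Fintype.card κ := Finset.card_image_le
      omega
  · rcases u with p | i <;> rcases v with p' | i' <;> simp only [baseGraph] at h
    · rcases h.2 with h | h <;> simp [nb, h]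
    · obtain ⟨j, h1, h2, -⟩ := h
      simpa [nb] using hTmem p i' j h1 h2
    · obtain ⟨j, h1, h2, -⟩ := h
      simpa [nb] using ⟨j, h2⟩

/-- Greedy construction: the legs can be attached in such a way that short closed walks have
label zero, and the root `inl 0` of the path is far from all star centres. -/
theorem exists_legs [Fintype ι] [Fintype κ] [DecidableEq ι] [DecidableEq κ] (b : ι → κ → A)
    (R N : ℕ) (hN : Fintype.card ι * Fintype.card κ + 2 * (Fintype.card κ + 4) ^ R ≤ N)
    (S : Finset (ι × κ)) :
    ∃ x : ι × κ → ℕ, (∀ e, x e < N) ∧ Set.InjOn x S ∧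
      (∀ u n a, LabelledWalk (baseGraph b S x) n u u a → n < R → a = 0) ∧
      ∀ i n a, LabelledWalk (baseGraph b S x) n (.inl 0) (.inr i) a → R ≤ n := by
  have hpow : 0 < (Fintype.card κ + 4) ^ R := by positivity
  induction S using Finset.induction_on with
  | empty =>
    refine ⟨fun _ ↦ 0, fun _ ↦ show 0 < N by omega, by simp, fun u n a p _ ↦ ?_, fun i n a p ↦ ?_⟩
    · have key : ∀ u v n a, LabelledWalk (baseGraph b (∅ : Finset (ι × κ)) fun _ ↦ 0) n u v a →
          a = 0 := by
        intro u v n a p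
        induction p with
        | nil => rfl
        | @cons u v w c a n e _ ih =>
          rcases u with p | i <;> rcases v with p' | i' <;> simp_all [baseGraph]
      exact key _ _ _ _ p
    · have key : ∀ u v n a, LabelledWalk (baseGraph b (∅ : Finset (ι × κ)) fun _ ↦ 0) n u v a →
          u.isLeft → v.isLeft := by
        intro u v n a p
        induction p with
        | nil => exact id
        | @cons u v w c a n e _ ih =>
          rcases u with p | i <;> rcases v with p' | i' <;> simp_all [baseGraph]
      simpa using key _ _ _ _ p
  | insert e S heS ih =>
    obtain ⟨i, j⟩ := e
    obtain ⟨x, hxN, hinj, hclosed, hroot⟩ := ih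
    obtain ⟨B₁, hB₁, hmem₁⟩ := exists_ball (b := b) hinj (.inr i) R
    obtain ⟨B₂, hB₂, hmem₂⟩ := exists_ball (b := b) hinj (.inl 0) R
    -- The position of the new leg avoids all earlier legs and two balls.
    obtain ⟨p, hpN, hpS, hp₁, hp₂⟩ : ∃ p < N, p ∉ S.image x ∧ .inl p ∉ B₁ ∧ .inl p ∉ B₂ := by
      have hS : S.card < Fintype.card ι * Fintype.card κ := by
        rw [← Fintype.card_prod, ← Finset.card_univ]
        exact Finset.card_lt_card (Finset.ssubset_univ_iff.2 fun h ↦ heS (h ▸ Finset.mem_univ _))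
      let bad := (S.image x).image (Sum.inl : ℕ → ℕ ⊕ ι) ∪ (B₁ ∪ B₂)
      have hbad : bad.card < ((Finset.range N).image (Sum.inl : ℕ → ℕ ⊕ ι)).card := by
        rw [Finset.card_image_of_injective _ Sum.inl_injective, Finset.card_range]
        have h1 := Finset.card_union_le ((S.image x).image (Sum.inl : ℕ → ℕ ⊕ ι)) (B₁ ∪ B₂)
        have h2 := Finset.card_union_le B₁ B₂
        have h3 : ((S.image x).image (Sum.inl : ℕ → ℕ ⊕ ι)).card ≤ S.card :=
          Finset.card_image_le.trans Finset.card_image_le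
        simp only [bad]
        omega
      obtain ⟨v, hv, hvbad⟩ := Finset.exists_mem_notMem_of_card_lt_card hbad
      obtain ⟨p, hp, rfl⟩ := Finset.mem_image.1 hv
      simp only [bad, Finset.mem_union, not_or] at hvbad
      refine ⟨p, by simpa using hp, fun h ↦ hvbad.1 (Finset.mem_image_of_mem _ h), hvbad.2⟩
    have hne : ∀ e ∈ S, Function.update x (i, j) p e = x e := fun e he ↦
      Function.update_of_ne (by rintro rfl; exact heS he) _ _
    have hfar : ∀ n a, LabelledWalk (baseGraph b S x) n (.inr i) (.inl p) a → R ≤ n := by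
      intro n a q
      by_contra hn
      exact hp₁ (hmem₁ _ _ _ q (by omega))
    have hE' : ∀ u v c, baseGraph b (insert (i, j) S : Finset (ι × κ)) (Function.update x (i, j) p)
        u v c → baseGraph b S x u v c ∨ (u = .inr i ∧ v = .inl p ∧ c = b i j) ∨
          (u = .inl p ∧ v = .inr i ∧ c = -b i j) := by
      intro u v c h
      rcases u with p₁ | i₁ <;> rcases v with p₂ | i₂
      · exact .inl h
      · obtain ⟨j', h1, h2, h3⟩ := h
        rcases Finset.mem_insert.1 (Finset.mem_coe.1 h1) with h1 | h1
        · obtain ⟨rfl, rfl⟩ := Prod.mk.inj h1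
          rw [Function.update_self] at h2
          exact .inr (.inr ⟨by rw [h2], rfl, h3⟩)
        · exact .inl ⟨j', h1, by rw [← h2, hne _ h1], h3⟩
      · obtain ⟨j', h1, h2, h3⟩ := h
        rcases Finset.mem_insert.1 (Finset.mem_coe.1 h1) with h1 | h1
        · obtain ⟨rfl, rfl⟩ := Prod.mk.inj h1
          rw [Function.update_self] at h2
          exact .inr (.inl ⟨rfl, by rw [h2], h3⟩)
        · exact .inl ⟨j', h1, by rw [← h2, hne _ h1], h3⟩
      · exact h.elim
    refine ⟨Function.update x (i, j) p, fun e ↦ ?_, ?_, fun u n a q hn ↦ ?_, fun i' n a q ↦ ?_⟩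
    · by_cases h : e = (i, j)
      · simpa [h] using hpN
      · simpa [Function.update_of_ne h] using hxN e
    · rw [Finset.coe_insert, Set.injOn_insert (by simpa using heS)]
      refine ⟨fun e he e' he' h ↦ hinj he he' (by rwa [hne e he, hne e' he'] at h), ?_⟩
      rintro ⟨e, he, h⟩
      rw [hne e he, Function.update_self] at h
      exact hpS (Finset.mem_image.2 ⟨e, he, h⟩)
    · rcases q.of_add_edge symm hE' hclosed hfar hn with ⟨n', h, q⟩ | ⟨n₁, n₂, a₁, a₂, h, q₁, q₂, -⟩ |
        ⟨n₁, n₂, a₁, a₂, h, q₁, q₂, -⟩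
      · exact hclosed _ _ _ q (by omega)
      · have := hfar _ _ ((q₂.append q₁).reverse symm)
        omega
      · have := hfar _ _ (q₂.append q₁)
        omega
    · by_contra! hn
      rcases q.of_add_edge symm hE' hclosed hfar hn with ⟨n', h, q⟩ | ⟨n₁, n₂, a₁, a₂, h, q₁, q₂, -⟩ |
        ⟨n₁, n₂, a₁, a₂, h, q₁, q₂, -⟩
      · have := hroot _ _ _ q
        omega
      · have := hroot _ _ _ q₁
        omega
      · exact hp₂ (hmem₂ _ _ _ q₁ (by omega))

end baseGraph

end LabelledWalks

/-! ### Entropy bounds and a counting bound for Steiner packings -/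

section Entropy

/-- A random variable that factors through a finite type `F` has entropy at most `log |F|`. -/
lemma entropy_comp_le {Ω Γ F : Type} [Fintype Ω] [Fintype F] (P : Ω → ℝ) (hP : ∀ ω, 0 ≤ P ω)
    (hsum : ∑ ω, P ω = 1) (f : Ω → F) (g : F → Γ) :
    entropy P (fun ω ↦ g (f ω)) ≤ Real.log (Fintype.card F) := by
  classical
  have hne : Nonempty Ω := by
    by_contra h
    rw [not_nonempty_iff] at h
    simp at hsum
  have hF : 0 < Fintype.card F := Fintype.card_pos_iff.2 (hne.map f)
  set M : ℝ := (Fintype.card F : ℝ) with hM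
  have hM0 : 0 < M := by rw [hM]; exact_mod_cast hF
  set X : Ω → Γ := fun ω ↦ g (f ω) with hX
  set p : Γ → ℝ := fun γ ↦ ∑ ω with X ω = γ, P ω with hp
  have hp0 : ∀ γ, 0 ≤ p γ := fun γ ↦ Finset.sum_nonneg fun ω _ ↦ hP ω
  have hpsum : ∑ γ ∈ Finset.univ.image X, p γ = 1 := by
    rw [← hsum]
    exact Finset.sum_fiberwise_of_maps_to (fun ω _ ↦ Finset.mem_image_of_mem X (Finset.mem_univ ω)) P
  have hcard : ((Finset.univ.image X).card : ℝ) ≤ M := by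
    have h1 : Finset.univ.image X ⊆ Finset.univ.image g := by
      intro γ hγ
      obtain ⟨ω, -, rfl⟩ := Finset.mem_image.1 hγ
      exact Finset.mem_image_of_mem g (Finset.mem_univ _)
    rw [hM, ← Finset.card_univ]
    exact_mod_cast (Finset.card_le_card h1).trans Finset.card_image_le
  -- `-p log p - p log M ≤ 1 / M - p`, as `log x ≤ x - 1`
  have key : ∀ γ, Real.negMulLog (p γ) ≤ p γ * Real.log M + (1 / M - p γ) := by
    intro γ
    rcases (hp0 γ).eq_or_lt with h | h
    · rw [← h]
      simp [hM0.le]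
    · have h1 := Real.log_le_sub_one_of_pos (show 0 < 1 / (p γ * M) by positivity)
      rw [Real.log_div one_ne_zero (by positivity), Real.log_one,
        Real.log_mul h.ne' hM0.ne'] at h1
      have h2 := mul_le_mul_of_nonneg_left h1 h.le
      have h3 : p γ * (1 / (p γ * M) - 1) = 1 / M - p γ := by field_simp
      rw [Real.negMulLog]
      nlinarith
  have h4 : ∑ γ ∈ Finset.univ.image X, Real.negMulLog (p γ) ≤
      ∑ γ ∈ Finset.univ.image X, (p γ * Real.log M + (1 / M - p γ)) :=
    Finset.sum_le_sum fun γ _ ↦ key γ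
  rw [Finset.sum_add_distrib, Finset.sum_sub_distrib, ← Finset.sum_mul, hpsum, Finset.sum_const,
    nsmul_eq_mul] at h4
  have h5 : ((Finset.univ.image X).card : ℝ) * (1 / M) ≤ 1 := by
    rw [mul_one_div, div_le_one hM0]
    exact hcard
  have h6 : entropy P X = ∑ γ ∈ Finset.univ.image X, Real.negMulLog (p γ) := by
    unfold entropy
    congr!
  rw [h6]
  linarith

lemma entropy_const_le {Ω Γ : Type} [Fintype Ω] (P : Ω → ℝ) (hP : ∀ ω, 0 ≤ P ω)
    (hsum : ∑ ω, P ω = 1) (γ : Γ) : entropy P (fun _ ↦ γ) ≤ 0 := by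
  simpa using entropy_comp_le P hP hsum (fun _ ↦ ()) (fun _ ↦ γ)

lemma entropy_uniform (F : Type) [Fintype F] [Nonempty F] :
    entropy (fun _ : F ↦ 1 / (Fintype.card F : ℝ)) id = Real.log (Fintype.card F) := by
  classical
  have h0 : (Fintype.card F : ℝ) ≠ 0 := by simp
  have : entropy (fun _ : F ↦ 1 / (Fintype.card F : ℝ)) id =
      ∑ _γ : F, Real.negMulLog (1 / (Fintype.card F : ℝ)) := by
    unfold entropy
    refine Finset.sum_congr (by ext; simp) fun γ _ ↦ ?_
    congr 1
    rw [Finset.sum_const, nsmul_eq_mul]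
    have : (Finset.univ.filter fun ω : F ↦ id ω = γ) = {γ} := by ext; simp
    rw [this]
    simp
  rw [this, Finset.sum_const, nsmul_eq_mul, Finset.card_univ, Real.negMulLog, Real.log_div one_ne_zero h0,
    Real.log_one]
  field_simp
  ring

end Entropy

namespace MulticastInstance

/-- Counting edges bounds the packing number: if every Steiner tree uses at least `b` edges of
the set `E₀`, then `k * b * τ ≤ |E₀|` for every packing of value `τ`. -/
lemma steinerPackingNumber_le {V : Type} {k : ℕ} [Finite V] (I : MulticastInstance V k)
    (hI : I.IsUnitInstance) (E₀ : Finset (Sym2 V)) (hE₀ : ∀ e ∈ E₀, e ∈ I.graph.edgeSet) {b : ℕ}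
    (hb : 0 < k * b)
    (h : ∀ i, ∀ T : I.graph.Subgraph, I.IsSteinerTree i T →
      ∃ E₁ ⊆ E₀, b ≤ E₁.card ∧ ∀ e ∈ E₁, e ∈ T.edgeSet) :
    I.steinerPackingNumber ≤ ENNReal.ofReal (E₀.card / (k * b : ℕ)) := by
  classical
  refine iSup₂_le fun τ hτ ↦ ?_
  obtain ⟨x, hx1, hx2⟩ := hτ
  have hmem : ∀ i, ∀ T ∈ I.steinerTrees i, I.IsSteinerTree i T := fun i T hT ↦ by
    simpa [steinerTrees] using hT
  have key : (k * b : ℕ) * τ ≤ E₀.card := by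
    calc ((k * b : ℕ) : ℝ≥0) * τ = ∑ i : Fin k, b * (τ * I.demand i) := by
          simp [hI.demand_eq_one, mul_assoc]
      _ ≤ ∑ i : Fin k, b * ∑ T ∈ I.steinerTrees i, x i T := by
          gcongr with i
          exact hx1 i
      _ ≤ ∑ i : Fin k, ∑ T ∈ I.steinerTrees i, ∑ e ∈ E₀, if e ∈ T.edgeSet then x i T else 0 := by
          refine Finset.sum_le_sum fun i _ ↦ ?_
          rw [Finset.mul_sum]
          refine Finset.sum_le_sum fun T hT ↦ ?_
          obtain ⟨E₁, hE₁, hcard, hT₁⟩ := h i T (hmem i T hT)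
          rw [← Finset.sum_filter, Finset.sum_const, nsmul_eq_mul]
          gcongr
          exact hcard.trans (Finset.card_le_card fun e he ↦
            Finset.mem_filter.2 ⟨hE₁ he, hT₁ e he⟩)
      _ = ∑ e ∈ E₀, ∑ i : Fin k, ∑ T ∈ I.steinerTrees i with e ∈ T.edgeSet, x i T := by
          rw [Finset.sum_comm]
          simp_rw [Finset.sum_filter]
          rw [Finset.sum_comm]
          conv_rhs => rw [Finset.sum_comm]
          exact Finset.sum_congr rfl fun i _ ↦ Finset.sum_comm
      _ ≤ ∑ e ∈ E₀, 1 := by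
          refine Finset.sum_le_sum fun e he ↦ ?_
          rw [← hI.cap_eq_one e (hE₀ e he)]
          convert! hx2 e (hE₀ e he)
      _ = E₀.card := by simp
  have hb' : (0 : ℝ) < (k * b : ℕ) := by exact_mod_cast hb
  rw [← ENNReal.ofReal_coe_nnreal]
  refine ENNReal.ofReal_le_ofReal ?_
  rw [le_div_iff₀ hb', mul_comm]
  exact_mod_cast key

lemma le_codingGap {V : Type} {k : ℕ} [Finite V] (I : MulticastInstance V k) {B g : ℝ}
    (hB : 0 < B) (hgB : g * B ≤ 1) (hthr : 1 ≤ I.throughput)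
    (hpack : I.steinerPackingNumber ≤ ENNReal.ofReal B) :
    ENNReal.ofReal g ≤ I.codingGap := by
  unfold codingGap
  calc ENNReal.ofReal g ≤ ENNReal.ofReal (1 / B) :=
        ENNReal.ofReal_le_ofReal (by rwa [le_div_iff₀ hB])
    _ = 1 / ENNReal.ofReal B := by rw [ENNReal.ofReal_div_of_pos hB, ENNReal.ofReal_one]
    _ ≤ _ := ENNReal.div_le_div hthr hpack

end MulticastInstance

/-! ### The covering instance and its coding solution -/

/-- An encoding of `k` messages over the alphabet `F` with one symbol `enc w m` for every element
`w` of the group `W`, such that the message `m i` can be recovered, for every base point `w`, from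
the `q` symbols at the points `w + query i j`. -/
structure QueryCode (k q : ℕ) (W F : Type) [AddCommGroup W] where
  enc : W → (Fin k → F) → F
  query : Fin k → Fin q → W
  decode : ∀ i w m m', (∀ j, enc (w + query i j) m = enc (w + query i j) m') → m i = m' i

/-- The vertices of the instance: for every `w : W` a copy of the vertices `inl 0, …, inl (N - 1)`
of the path and of the star centres `inr i` of the base graph, and `K` further vertices. -/
abbrev CoverVertex (W : Type) (N k K : ℕ) : Type := (W × (Fin N ⊕ Fin k)) ⊕ Fin K

namespace CoverVertex

variable {W : Type} [AddCommGroup W] {N k K q : ℕ}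

/-- The darts that carry information: from the sources to the roots of the paths, along the paths,
and from the paths to the sinks. The path with index `w + b i j` is joined to the star centre with
index `w`. -/
inductive Forward (b : Fin k → Fin q → W) (x : Fin k × Fin q → ℕ) :
    CoverVertex W N k K → CoverVertex W N k K → Prop
  | source (s : Fin K) (w : W) (p : Fin N) (hp : p.val = 0) :
      Forward b x (.inr s) (.inl (w, .inl p))
  | path (w : W) (p p' : Fin N) (h : p'.val = p.val + 1) :
      Forward b x (.inl (w, .inl p)) (.inl (w, .inl p'))
  | leg (w : W) (i : Fin k) (j : Fin q) (p : Fin N) (h : p.val = x (i, j)) :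
      Forward b x (.inl (w + b i j, .inl p)) (.inl (w, .inr i))

variable {b : Fin k → Fin q → W} {x : Fin k × Fin q → ℕ}

/-- Information flows upwards with respect to this rank. -/
def rank : CoverVertex W N k K → ℕ
  | .inr _ => 0
  | .inl (_, .inl p) => p.val + 1
  | .inl (_, .inr _) => N + 1

lemma Forward.rank_lt {u v : CoverVertex W N k K} (h : Forward b x u v) : rank u < rank v := by
  cases h with
  | source s w p hp => simp [rank]
  | path w p p' h => simp [rank, h]
  | leg w i j p h => simp [rank]

lemma Forward.irrefl (u : CoverVertex W N k K) : ¬ Forward b x u u := fun h ↦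
  h.rank_lt.false

lemma Forward.asymm {u v : CoverVertex W N k K} (h : Forward b x u v) : ¬ Forward b x v u :=
  fun h' ↦ h.rank_lt.asymm h'.rank_lt

/-- The projection of a copy of the base graph to the base graph. -/
def toBase : Fin N ⊕ Fin k → ℕ ⊕ Fin k := Sum.map Fin.val id

/-- A covering map: the edges between the copies of the base graph project to edges of the base
graph, and the label of an edge is the difference of the indices of its end points. -/
lemma Forward.baseGraph {w w' : W} {y y' : Fin N ⊕ Fin k}
    (h : Forward b x (.inl (w, y) : CoverVertex W N k K) (.inl (w', y'))) :
    baseGraph b Set.univ x (toBase y) (toBase y') (w' - w) := by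
  cases h with
  | path w p p' h => exact ⟨by simp, .inl h⟩
  | leg w i j p h => exact ⟨j, trivial, h.symm, by abel⟩

lemma Forward.baseGraph_of_or {w w' : W} {y y' : Fin N ⊕ Fin k}
    (h : Forward b x (.inl (w, y) : CoverVertex W N k K) (.inl (w', y')) ∨
      Forward b x (.inl (w', y') : CoverVertex W N k K) (.inl (w, y))) :
    NetworkCoding.baseGraph b Set.univ x (toBase y) (toBase y') (w' - w) := by
  rcases h with h | h
  · exact h.baseGraph
  · simpa using NetworkCoding.baseGraph.symm _ _ _ h.baseGraph

/-- The time before which a vertex is silent. -/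
def delay : CoverVertex W N k K → ℕ
  | .inl (_, .inl p) => p.val + 1
  | _ => 0

open Classical in
/-- What a vertex transmits: the sources their message, the path with index `w` the code symbol at
`w`. The values elsewhere are irrelevant. -/
noncomputable def value {F : Type} [Nonempty F] (C : QueryCode k q W F) :
    CoverVertex W N k K → (Fin k → F) → F
  | .inr s, m => if h : s.val < k then m ⟨s.val, h⟩ else Classical.arbitrary F
  | .inl (w, .inl _), m => C.enc w m
  | .inl (_, .inr _), _ => Classical.arbitrary F

end CoverVertex

open CoverVertex

section Instance

variable {V W F : Type} [AddCommGroup W] {N k K q : ℕ}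

/-- The multicast instance of a query code, on a vertex set identified with `CoverVertex W N k K`:
session `i` goes from the `i`-th source to all copies of the star centre `i`. -/
def coverInstance (pos : V ≃ CoverVertex W N k K) (hK : k ≤ K) (b : Fin k → Fin q → W)
    (x : Fin k × Fin q → ℕ) : MulticastInstance V k where
  graph :=
    { Adj := fun u v ↦ Forward b x (pos u) (pos v) ∨ Forward b x (pos v) (pos u)
      symm := ⟨fun _ _ h ↦ h.symm⟩
      loopless := ⟨fun _ h ↦ Forward.irrefl _ (h.elim id id)⟩ }
  cap := fun _ ↦ 1
  source := fun i ↦ pos.symm (.inr (Fin.castLE hK i))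
  sinks := fun i ↦ {v | ∃ w, pos v = .inl (w, .inr i)}
  demand := fun _ ↦ 1

variable (pos : V ≃ CoverVertex W N k K) (hK : k ≤ K)

lemma coverInstance_isUnit (b : Fin k → Fin q → W) (x : Fin k × Fin q → ℕ) (hk : 0 < k)
    (hq : 0 < q) (hx : ∀ e, x e < N) : (coverInstance pos hK b x).IsUnitInstance where
  connected := by
    set G := (coverInstance pos hK b x).graph
    have hN : 0 < N := (Nat.zero_le _).trans_lt (hx (⟨0, hk⟩, ⟨0, hq⟩))
    have hadj : ∀ {u v : CoverVertex W N k K}, Forward b x u v →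
        G.Reachable (pos.symm u) (pos.symm v) := fun {u v} h ↦
      SimpleGraph.Adj.reachable (show Forward b x _ _ ∨ _ from by simp [h])
    have hroot : ∀ (w : W) (n : ℕ) (hn : n < N),
        G.Reachable (pos.symm (.inl (w, .inl ⟨n, hn⟩))) (pos.symm (.inl (w, .inl ⟨0, hN⟩))) := by
      intro w n
      induction n with
      | zero => exact fun _ ↦ .rfl
      | succ n ih =>
        exact fun hn ↦ (hadj (.path w ⟨n, by omega⟩ ⟨n + 1, hn⟩ rfl)).symm.trans (ih (by omega))
    have hs : ∀ (w : W) (n : ℕ) (hn : n < N), G.Reachable (pos.symm (.inl (w, .inl ⟨n, hn⟩)))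
        (pos.symm (.inr ⟨0, by omega⟩)) := fun w n hn ↦
      (hroot w n hn).trans (hadj (.source ⟨0, by omega⟩ w ⟨0, hN⟩ rfl)).symm
    have hall : ∀ u : CoverVertex W N k K,
        G.Reachable (pos.symm u) (pos.symm (.inr ⟨0, by omega⟩)) := by
      rintro (⟨w, p | i⟩ | s)
      · exact hs w p.1 p.2
      · exact (hadj (.leg w i ⟨0, hq⟩ ⟨_, hx _⟩ rfl)).symm.trans (hs _ _ _)
      · exact (hadj (.source s 0 ⟨0, hN⟩ rfl)).trans (hs 0 0 hN)
    have : Nonempty V := ⟨pos.symm (.inr ⟨0, by omega⟩)⟩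
    refine ⟨fun u v ↦ ?_⟩
    have h := (hall (pos u)).trans (hall (pos v)).symm
    simpa using h
  cap_eq_one _ _ := rfl
  demand_eq_one _ := rfl
  sinks_nonempty i := ⟨pos.symm (.inl (0, .inr i)), 0, by simp⟩
  source_notMem_sinks i := by
    rintro ⟨w, h⟩
    simp [coverInstance] at h

open Classical in
/-- The coding solution: the symbol `enc w m` travels along the path with index `w`, and every sink
receives the symbols that it needs to decode. All messages are uniform and independent. -/
noncomputable def coverSolution [Fintype F] [Nonempty F] (C : QueryCode k q W F)
    (x : Fin k × Fin q → ℕ) (hx : ∀ e, x e < N) : (coverInstance pos hK C.query x).Solution where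
  Msg _ := F
  dist _ _ := 1 / Fintype.card F
  dist_nonneg _ _ := by positivity
  dist_sum _ := by simp
  Alphabet _ _ := Option F
  symbol d t m :=
    if Forward C.query x (pos d.fst) (pos d.snd) ∧ delay (pos d.fst) ≤ t then
      some (value C (pos d.fst) m) else none
  causality d t m m' hm hd := by
    by_cases hc : Forward C.query x (pos d.fst) (pos d.snd) ∧ delay (pos d.fst) ≤ t
    swap
    · simp only [if_neg hc]
    simp only [if_pos hc]
    congr 1
    obtain ⟨hfw, ht⟩ := hc
    rcases hu : pos d.fst with ⟨w, p | i⟩ | s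
    · rw [hu] at ht
      simp only [delay] at ht
      obtain ⟨p, hp⟩ := p
      cases p with
      | zero =>
        -- The root of a path has received all messages.
        have : m = m' := by
          funext i
          have hf : Forward C.query x (pos (pos.symm (.inr (Fin.castLE hK i)))) (pos d.fst) := by
            rw [hu, Equiv.apply_symm_apply]
            exact .source _ _ _ rfl
          have := hd ⟨(pos.symm (.inr (Fin.castLE hK i)), d.fst), .inl hf⟩ rfl 0 (by omega)
          rw [Equiv.apply_symm_apply] at hf
          simpa [hf, delay, value] using this
        rw [this]
      | succ p =>
        have hf : Forward C.query x (pos (pos.symm (.inl (w, .inl ⟨p, by omega⟩)))) (pos d.fst) := by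
          rw [hu, Equiv.apply_symm_apply]
          exact .path _ _ _ rfl
        have := hd ⟨(pos.symm (.inl (w, .inl ⟨p, by omega⟩)), d.fst), .inl hf⟩ rfl (p + 1)
          (by simp at ht; omega)
        rw [Equiv.apply_symm_apply] at hf
        simpa [hf, delay, value] using this
    · simp [value]
    · by_cases hs : s.val < k
      · have := hm ⟨s.val, hs⟩ (by simp [coverInstance, Equiv.symm_apply_eq, hu, Fin.castLE])
        simpa [value, hs] using this
      · simp [value, hs]
  correctness i v hv m m' _ hd := by
    obtain ⟨w, hw⟩ := hv
    refine C.decode i w m m' fun j ↦ ?_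
    have hf : Forward C.query x
        (pos (pos.symm (.inl (w + C.query i j, .inl ⟨x (i, j), hx _⟩)))) (pos v) := by
      rw [hw, Equiv.apply_symm_apply]
      exact .leg _ _ _ _ rfl
    have := hd ⟨(pos.symm (.inl (w + C.query i j, .inl ⟨x (i, j), hx _⟩)), v), .inl hf⟩ rfl
      (x (i, j) + 1)
    rw [Equiv.apply_symm_apply] at hf
    simpa [hf, delay, value] using this

lemma one_le_throughput_coverInstance [Fintype F] [Nontrivial F] (C : QueryCode k q W F)
    (x : Fin k × Fin q → ℕ) (hx : ∀ e, x e < N) :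
    1 ≤ (coverInstance pos hK C.query x).throughput := by
  classical
  set S := coverSolution pos hK C x hx with hS
  have hlog : 0 < Real.log (Fintype.card F) :=
    Real.log_pos (by exact_mod_cast Fintype.one_lt_card)
  have hP0 : ∀ m, 0 ≤ S.prob m := fun m ↦ Finset.prod_nonneg fun i _ ↦ S.dist_nonneg i _
  have hP1 : ∑ m, S.prob m = 1 := by
    unfold MulticastInstance.Solution.prob
    rw [← Fintype.piFinset_univ, ← Finset.prod_univ_sum]
    simp [S.dist_sum]
  have hdart : ∀ d, S.dartEntropy d ≤ Real.log (Fintype.card F) := fun d ↦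
    entropy_comp_le S.prob hP0 hP1 (value C (pos d.fst)) fun a (t : ℕ) ↦
      if Forward C.query x (pos d.fst) (pos d.snd) ∧ delay (pos d.fst) ≤ t then some a else none
  have hdart0 : ∀ d, ¬ Forward C.query x (pos d.fst) (pos d.snd) → S.dartEntropy d ≤ 0 := by
    intro d hd
    have : S.dartEntropy d = entropy S.prob fun _ (_ : ℕ) ↦ (none : Option F) := by
      unfold MulticastInstance.Solution.dartEntropy
      congr 1
      funext m t
      exact if_neg fun h ↦ hd h.1
    rw [this]
    exact entropy_const_le S.prob hP0 hP1 _
  refine le_iSup₂_of_le (1 : ℝ≥0) ⟨S, Real.log (Fintype.card F), hlog, fun i ↦ ?_, fun d ↦ ?_⟩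
    (by simp)
  · have : S.sourceEntropy i = Real.log (Fintype.card F) := entropy_uniform F
    rw [this]
    simp [coverInstance]
  · have hcap : (coverInstance pos hK C.query x).cap d.edge = 1 := rfl
    rw [hcap, NNReal.coe_one, one_mul]
    by_cases hf : Forward C.query x (pos d.fst) (pos d.snd)
    · have := hdart d
      have := hdart0 d.symm hf.asymm
      linarith
    · have := hdart d.symm
      have := hdart0 d hf
      linarith

end Instance

/-! ### Steiner trees in the covering instance -/

open CoverVertex

section SteinerTrees

variable {V W : Type} [AddCommGroup W] {N k K q : ℕ}

/-- The number of edges of the copies of the base graph is at most `|W| * (N + k * q)`. -/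
lemma exists_coverEdges [Fintype W] [Finite V] (pos : V ≃ CoverVertex W N k K) (hK : k ≤ K)
    (b : Fin k → Fin q → W) (x : Fin k × Fin q → ℕ) (hx : ∀ e, x e < N) :
    ∃ E₀ : Finset (Sym2 V), E₀.card ≤ Fintype.card W * (N + k * q) ∧
      (∀ e ∈ E₀, e ∈ (coverInstance pos hK b x).graph.edgeSet) ∧
      ∀ u v, (coverInstance pos hK b x).graph.Adj u v → (pos u).isLeft → (pos v).isLeft →
        s(u, v) ∈ E₀ := by
  classical
  let g : (W × Fin N) ⊕ (W × Fin k × Fin q) → Sym2 V := fun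
    | .inl (w, p) => s(pos.symm (.inl (w, .inl p)),
        pos.symm (.inl (w, .inl (if h : p.val + 1 < N then ⟨p.val + 1, h⟩ else p))))
    | .inr (w, i, j) => s(pos.symm (.inl (w + b i j, .inl ⟨x (i, j), hx _⟩)),
        pos.symm (.inl (w, .inr i)))
  have hg : ∀ U U' : CoverVertex W N k K, Forward b x U U' → U.isLeft →
      ∃ z, g z = s(pos.symm U, pos.symm U') := by
    intro U U' h hU
    cases h with
    | source => simp at hU
    | path w p p' h =>
      have h' : p.val + 1 < N := h ▸ p'.2
      refine ⟨.inl (w, p), ?_⟩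
      have : p' = ⟨p.val + 1, h'⟩ := Fin.ext h
      simp [g, h', this]
    | leg w i j p h =>
      refine ⟨.inr (w, i, j), ?_⟩
      have : p = ⟨x (i, j), hx _⟩ := Fin.ext h
      simp [g, this]
  refine ⟨(Finset.univ.image g).filter (· ∈ (coverInstance pos hK b x).graph.edgeSet), ?_,
    fun e he ↦ (Finset.mem_filter.1 he).2, fun u v huv hu hv ↦ Finset.mem_filter.2 ⟨?_, huv⟩⟩
  · refine (Finset.card_filter_le _ _).trans (Finset.card_image_le.trans (le_of_eq ?_))
    simp [mul_add]
  · rcases huv with h | h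
    · obtain ⟨z, hz⟩ := hg _ _ h hu
      exact Finset.mem_image.2 ⟨z, Finset.mem_univ _, by simpa using hz⟩
    · obtain ⟨z, hz⟩ := hg _ _ h hv
      exact Finset.mem_image.2 ⟨z, Finset.mem_univ _, by simpa [Sym2.eq_swap] using hz⟩

/-- The vertices that can be reached from the sink `(w, i)` by lifting a walk of length at most `r`
in the base graph. -/
def liftedBall (pos : V ≃ CoverVertex W N k K) (b : Fin k → Fin q → W) (x : Fin k × Fin q → ℕ)
    (i : Fin k) (w : W) (r : ℕ) : Set V :=
  {v | ∃ y a, ∃ m ≤ r, pos v = .inl (w + a, y) ∧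
    LabelledWalk (baseGraph b Set.univ x) m (.inr i) (toBase y) a}

/-- A Steiner tree leaves the ball of radius `ρ` around each of its sinks, and these balls are
disjoint since short closed walks of the base graph have label zero. -/
lemma exists_edges_of_isSteinerTree [Fintype W] (pos : V ≃ CoverVertex W N k K) (hK : k ≤ K)
    (b : Fin k → Fin q → W) (x : Fin k × Fin q → ℕ) {ρ : ℕ}
    (hclosed : ∀ u n a, LabelledWalk (baseGraph b Set.univ x) n u u a → n < 2 * ρ + 1 → a = 0)
    (hroot : ∀ i n a, LabelledWalk (baseGraph b Set.univ x) n (.inl 0) (.inr i) a →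
      2 * ρ + 1 ≤ n)
    {E₀ : Finset (Sym2 V)}
    (hE₀ : ∀ u v, (coverInstance pos hK b x).graph.Adj u v → (pos u).isLeft → (pos v).isLeft →
        s(u, v) ∈ E₀)
    (i : Fin k) (T : (coverInstance pos hK b x).graph.Subgraph)
    (hT : (coverInstance pos hK b x).IsSteinerTree i T) :
    ∃ E₁ ⊆ E₀, ρ * Fintype.card W ≤ E₁.card ∧ ∀ e ∈ E₁, e ∈ T.edgeSet := by
  classical
  set B := liftedBall pos b x i with hB
  have hmono : ∀ w r r', r ≤ r' → B w r ⊆ B w r' := by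
    rintro w r r' hr v ⟨y, a, m, hm, hv⟩
    exact ⟨y, a, m, hm.trans hr, hv⟩
  have hdisj : ∀ w w' r r' v, r ≤ ρ → r' ≤ ρ → v ∈ B w r → v ∈ B w' r' → w = w' := by
    rintro w w' r r' v hr hr' ⟨y, a, m, hm, hv, p⟩ ⟨y', a', m', hm', hv', p'⟩
    rw [hv] at hv'
    obtain ⟨h1, rfl⟩ := Prod.mk.inj (Sum.inl_injective hv')
    have := hclosed _ _ _ (p.append (p'.reverse baseGraph.symm)) (by omega)
    rw [← sub_eq_add_neg, sub_eq_zero] at this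
    subst this
    exact add_right_cancel h1
  have hcross : ∀ z : W × Fin ρ, ∃ e ∈ E₀, e ∈ T.edgeSet ∧ ∃ u v, e = s(u, v) ∧
      u ∈ B z.1 z.2 ∧ v ∉ B z.1 z.2 ∧ v ∈ B z.1 (z.2 + 1) := by
    rintro ⟨w, r, hr⟩
    have hτ : pos.symm (.inl (w, .inr i)) ∈ T.verts :=
      hT.2 (Set.mem_insert_of_mem _ ⟨w, by simp⟩)
    have hs : pos.symm (.inr (Fin.castLE hK i)) ∈ T.verts := hT.2 (Set.mem_insert _ _)
    obtain ⟨p⟩ := hT.1.connected.preconnected ⟨_, hτ⟩ ⟨_, hs⟩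
    obtain ⟨d, -, hd1, hd2⟩ := p.exists_boundary_dart {z | z.1 ∈ B w r}
      ⟨.inr i, 0, 0, Nat.zero_le _, by simp, .nil _⟩ (by
        rintro ⟨y, a, m, hm, hv, -⟩
        simp at hv)
    have hadj : T.Adj d.fst.1 d.snd.1 := d.adj
    obtain ⟨y, a, m, hm, hu, q⟩ := hd1
    have hG := hadj.adj_sub
    rcases hv : pos d.snd.1 with ⟨w', y'⟩ | s
    · refine ⟨s(d.fst.1, d.snd.1), hE₀ _ _ hG (by simp [hu]) (by simp [hv]), hadj, _, _, rfl,
        ⟨y, a, m, hm, hu, q⟩, hd2, y', w' - w, m + 1, by simpa using hm, by simp [hv], ?_⟩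
      have hG' : Forward b x (pos d.fst.1) (pos d.snd.1) ∨
        Forward b x (pos d.snd.1) (pos d.fst.1) := hG
      rw [hu, hv] at hG'
      have := q.snoc (Forward.baseGraph_of_or hG')
      rwa [show a + (w' - (w + a)) = w' - w by abel] at this
    · -- Only the roots of the paths are adjacent to sources, and they are far from the sinks.
      exfalso
      have hG' : Forward b x (pos d.fst.1) (pos d.snd.1) ∨
        Forward b x (pos d.snd.1) (pos d.fst.1) := hG
      rw [hu, hv] at hG'
      rcases hG' with h | h
      · generalize w + a = w₁ at h
        cases h
      · cases h with
        | source _ _ p hp =>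
          have h0 : toBase (.inl p : Fin N ⊕ Fin k) = .inl 0 := by simp [toBase, hp]
          rw [h0] at q
          have := hroot _ _ _ (q.reverse baseGraph.symm)
          have hm' : m ≤ r := hm
          omega
  choose f hf₀ hfT u v hf hu hv hv' using hcross
  have hinj : Function.Injective f := by
    rintro ⟨w, r⟩ ⟨w', r'⟩ h
    have hu₁ : ∀ z, u z ∈ B z.1 (z.2 + 1) := fun z ↦ hmono _ _ _ (Nat.le_succ _) (hu z)
    have hboth : ∀ z, ∀ t ∈ f z, t ∈ B z.1 (z.2 + 1) := by
      intro z t ht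
      rw [hf z, Sym2.mem_iff] at ht
      rcases ht with rfl | rfl
      exacts [hu₁ z, hv' z]
    have hmem : ∀ z, v z ∈ f z := fun z ↦ by rw [hf z]; simp
    have hw : w = w' := hdisj w w' _ _ (v (w, r)) (show r.val + 1 ≤ ρ by omega)
      (show r'.val + 1 ≤ ρ by omega) (hboth (w, r) _ (hmem _)) (hboth (w', r') _ (h ▸ hmem _))
    subst hw
    -- The far end of the outer of the two edges would lie in the ball left by that edge.
    have key : ∀ r r' : Fin ρ, f (w, r) = f (w, r') → ¬ r < r' := by
      intro r r' h hlt
      exact hv (w, r') (hmono w (r + 1) r' hlt (hboth (w, r) _ (h ▸ hmem (w, r'))))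
    have := key r r' h
    have := key r' r h.symm
    rw [le_antisymm (not_lt.1 ‹¬ r' < r›) (not_lt.1 ‹¬ r < r'›)]
  refine ⟨Finset.univ.image f, fun e he ↦ ?_, ?_, fun e he ↦ ?_⟩
  · obtain ⟨z, -, rfl⟩ := Finset.mem_image.1 he
    exact hf₀ z
  · rw [Finset.card_image_of_injective _ hinj]
    simp [mul_comm]
  · obtain ⟨z, -, rfl⟩ := Finset.mem_image.1 he
    exact hfT z

end SteinerTrees

/-- A code with `q` queries yields instances of coding gap `ρ / (4 q)` for
`ρ` of the order `log k / log q`, on any sufficiently large number of vertices. -/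
theorem exists_instance_of_queryCode {k q : ℕ} {W F : Type} [AddCommGroup W] [Fintype W]
    [Fintype F] [Nontrivial F] (C : QueryCode k q W F) (hk : 0 < k) (hq : 0 < q) {ρ : ℕ}
    (hρ : (q + 4) ^ (2 * ρ + 1) ≤ k) {n : ℕ} (hn : Fintype.card W * (k * (q + 4)) ≤ n) :
    ∃ I : MulticastInstance (Fin n) k, I.IsUnitInstance ∧
      ENNReal.ofReal (ρ / (4 * q)) ≤ I.codingGap := by
  classical
  set N := k * q + 2 * (q + 4) ^ (2 * ρ + 1) with hN
  obtain ⟨x, hxN, -, hclosed, hroot⟩ := baseGraph.exists_legs C.query (2 * ρ + 1) N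
    (by simp [hN]) (Finset.univ : Finset (Fin k × Fin q))
  rw [Finset.coe_univ] at hclosed hroot
  have hW : 0 < Fintype.card W := Fintype.card_pos
  have hsize : Fintype.card W * (N + k) + k ≤ n := by
    refine le_trans ?_ hn
    calc Fintype.card W * (N + k) + k ≤ Fintype.card W * (N + k) + Fintype.card W * k := by
          gcongr
          exact Nat.le_mul_of_pos_left _ hW
      _ ≤ Fintype.card W * ((k * q + 2 * k) + k) + Fintype.card W * k := by rw [hN]; gcongr
      _ = _ := by ring
  obtain ⟨K, hKn⟩ := Nat.exists_eq_add_of_le hsize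
  have hcard : Fintype.card (Fin n) = Fintype.card (CoverVertex W N k (k + K)) := by
    simp [hKn, add_assoc]
  let pos : Fin n ≃ CoverVertex W N k (k + K) := Fintype.equivOfCardEq hcard
  have hK : k ≤ k + K := Nat.le_add_right _ _
  have hunit := coverInstance_isUnit pos hK C.query x hk hq hxN
  refine ⟨coverInstance pos hK C.query x, hunit, ?_⟩
  rcases Nat.eq_zero_or_pos ρ with rfl | hρ0
  · simp
  obtain ⟨E₀, hE₀card, hE₀edge, hE₀⟩ := exists_coverEdges pos hK C.query x hxN
  have hq' : (0 : ℝ) < q := by exact_mod_cast hq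
  have hρ' : (0 : ℝ) < ρ := by exact_mod_cast hρ0
  refine MulticastInstance.le_codingGap _ (B := 4 * q / ρ) (by positivity)
    (by field_simp; exact le_rfl) (one_le_throughput_coverInstance pos hK C x hxN)
    ((MulticastInstance.steinerPackingNumber_le _ hunit E₀ hE₀edge
      (b := ρ * Fintype.card W) (by positivity) fun i T hT ↦
        exists_edges_of_isSteinerTree pos hK C.query x hclosed hroot hE₀ i T hT).trans
      (ENNReal.ofReal_le_ofReal ?_))
  have hE : E₀.card ≤ 4 * q * k * Fintype.card W := by
    refine hE₀card.trans ?_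
    calc Fintype.card W * (N + k * q) ≤ Fintype.card W * ((k * q + 2 * (k * q)) + k * q) := by
          rw [hN]
          gcongr
          exact hρ.trans (Nat.le_mul_of_pos_right _ hq)
      _ = _ := by ring
  have hk' : (0 : ℝ) < k := by exact_mod_cast hk
  have hW' : (0 : ℝ) < Fintype.card W := by exact_mod_cast hW
  have hE' : (E₀.card : ℝ) ≤ 4 * q * k * Fintype.card W := by exact_mod_cast hE
  push_cast
  rw [div_le_div_iff₀ (by positivity) hρ']
  nlinarith [mul_le_mul_of_nonneg_right hE' hρ'.le]

/-! ### Matching vector codes -/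

section MatchingVectors

/-- In characteristic `p`, the `p ^ e`-th forward difference is `f (y + p ^ e) - f y`. -/
lemma fwdDiff_iter_prime_pow {p : ℕ} [Fact p.Prime] (e : ℕ) (f : ℕ → ZMod p) (y : ℕ) :
    (fwdDiff 1)^[p ^ e] f y = f (y + p ^ e) - f y := by
  have hp : p.Prime := Fact.out
  have hpe : 0 < p ^ e := pow_pos hp.pos e
  rw [fwdDiff_iter_eq_sum_shift, Finset.sum_range_succ,
    Finset.sum_eq_single_of_mem 0 (Finset.mem_range.2 hpe)]
  · have : ((-1 : ZMod p)) ^ (p ^ e) = -1 := by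
      have := FiniteField.pow_card_pow e (-1 : ZMod p)
      rwa [ZMod.card p] at this
    simp [zsmul_eq_mul, this]
    ring
  · intro s hs hs0
    have : p ∣ (p ^ e).choose s := hp.dvd_choose_pow hs0 (Finset.mem_range.1 hs).ne
    rw [zsmul_eq_mul]
    simp [(ZMod.natCast_eq_zero_iff _ _).2 this]

lemma fwdDiff_iter_eq_zero_of_periodic {p : ℕ} [Fact p.Prime] {e : ℕ} {f : ℕ → ZMod p}
    (hf : ∀ y, f (y + p ^ e) = f y) {s : ℕ} (hs : p ^ e ≤ s) (y : ℕ) :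
    (fwdDiff 1)^[s] f y = 0 := by
  obtain ⟨r, rfl⟩ := Nat.exists_eq_add_of_le' hs
  rw [Function.iterate_add_apply]
  have : (fwdDiff 1)^[p ^ e] f = fun _ ↦ 0 := by
    funext y
    rw [fwdDiff_iter_prime_pow, hf, sub_self]
  rw [this]
  have h0 : ∀ r, (fwdDiff 1)^[r] (fun _ : ℕ ↦ (0 : ZMod p)) = fun _ ↦ 0 := by
    intro r
    induction r with
    | zero => rfl
    | succ r ih => rw [Function.iterate_succ_apply', ih]; funext; simp [fwdDiff]
  rw [h0]

/-- Newton's formula: modulo `p`, a `p ^ e`-periodic function is a polynomial of degree less than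
`p ^ e` in the sense of binomial coefficients. Its value at the cardinality of a set is therefore a
sum over the small subsets of that set. For an intersection `B ∩ C` the sum is an inner product,
since `J ⊆ B ∩ C` if and only if `J ⊆ B` and `J ⊆ C`. -/
lemma sum_subsets_fwdDiff {p : ℕ} [Fact p.Prime] {e d : ℕ} {f : ℕ → ZMod p}
    (hf : ∀ y, f (y + p ^ e) = f y) (hd : p ^ e ≤ d + 1) {U : Type*} [Fintype U] [DecidableEq U]
    (A : Finset U) :
    ∑ J : {J : Finset U // J.card ≤ d}, (if J.1 ⊆ A then (fwdDiff 1)^[J.1.card] f 0 else 0) =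
      f A.card := by
  have h1 := shift_eq_sum_fwdDiff_iter 1 f A.card 0
  simp only [smul_eq_mul, mul_one, zero_add] at h1
  have h2 : A.powerset = Finset.univ.filter (· ⊆ A) := by ext; simp
  rw [h1, ← Finset.sum_powerset_apply_card (fun s ↦ (fwdDiff 1)^[s] f 0), h2, Finset.sum_filter,
    ← Finset.sum_subtype (Finset.univ.filter fun J : Finset U ↦ J.card ≤ d) (by simp)
      (fun J ↦ if J ⊆ A then (fwdDiff 1)^[J.card] f 0 else 0), Finset.sum_filter]
  refine Finset.sum_congr rfl fun J _ ↦ ?_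
  split_ifs with h3 h4 h4 <;> try rfl
  exact (fwdDiff_iter_eq_zero_of_periodic hf (by omega) 0).symm

/-- The graph of `a`, as a subset of `Fin n × Bool`. Two such sets meet in exactly `n` points only
if they are equal. -/
def graphSet {n : ℕ} (a : Fin n → Bool) : Finset (Fin n × Bool) := Finset.univ.image fun j ↦ (j, a j)

lemma mem_graphSet {n : ℕ} {a : Fin n → Bool} {z : Fin n × Bool} :
    z ∈ graphSet a ↔ a z.1 = z.2 := by
  simp [graphSet, Prod.ext_iff]

lemma card_graphSet {n : ℕ} (a : Fin n → Bool) : (graphSet a).card = n := by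
  rw [graphSet, Finset.card_image_of_injective _ fun i j h ↦ (Prod.mk.inj h).1]
  simp

lemma eq_of_card_graphSet_inter {n : ℕ} {a b : Fin n → Bool}
    (h : (graphSet a ∩ graphSet b).card = n) : a = b := by
  have h1 : graphSet a ∩ graphSet b = graphSet a :=
    Finset.eq_of_subset_of_card_le Finset.inter_subset_left (by rw [h, card_graphSet])
  funext j
  have h2 : (j, a j) ∈ graphSet a ∩ graphSet b := by rw [h1]; exact mem_graphSet.2 rfl
  exact (mem_graphSet.1 (Finset.mem_inter.1 h2).2).symm

/-- A finite field that contains nontrivial `p i`-th roots of unity for all `i`. -/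
lemma exists_field_with_roots {t : ℕ} {p : Fin t → ℕ} (hp : ∀ i, (p i).Prime) :
    ∃ l : ℕ, l.Prime ∧ ∃ γ : Fin t → ZMod l, ∀ i, γ i ^ p i = 1 ∧ γ i ≠ 1 := by
  obtain ⟨l, hl, -, hmod⟩ := Nat.exists_prime_gt_modEq_one (k := ∏ i, p i) 0
    (Finset.prod_ne_zero_iff.2 fun i _ ↦ (hp i).ne_zero)
  have : Fact l.Prime := ⟨hl⟩
  have h : ∀ i, ∃ γ : ZMod l, γ ^ p i = 1 ∧ γ ≠ 1 := by
    intro i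
    have : Fact (p i).Prime := ⟨hp i⟩
    have hdvd : p i ∣ Fintype.card (ZMod l)ˣ := by
      rw [ZMod.card_units]
      exact (Finset.dvd_prod_of_mem p (Finset.mem_univ i)).trans
        ((Nat.modEq_iff_dvd' hl.one_lt.le).1 hmod.symm)
    obtain ⟨u, hu⟩ := exists_prime_orderOf_dvd_card (p i) hdvd
    refine ⟨u, ?_, fun h1 ↦ ?_⟩
    · rw [← Units.val_pow_eq_pow_val, ← hu, pow_orderOf_eq_one, Units.val_one]
    · rw [Units.val_eq_one.1 h1, orderOf_one] at hu
      exact (hp i).one_lt.ne hu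
  choose γ hγ using h
  exact ⟨l, hl, γ, hγ⟩

/-- The matching vector code: messages are indexed by `a : Fin n → Bool` and points by
`w = (w i)`, where `w i` is a vector over `ZMod (p i)` indexed by the sets of at most `d` elements.
The message `a` is modulated by the character `∏ i, ψ i ⟨u a, w i⟩`, where `u a` is the indicator
of the subsets of `graphSet a`. There is a vector `v a` such that `⟨u b, v a⟩` in `ZMod (p i)` is
`0` or `1`, is `0` for all `i` if `b = a`, and is `1` for some `i` otherwise. Hence the product over
all `i` of the difference operators `(shift by v a in the component i) - ψ i 1` annihilates all
characters but that of `a`. -/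
theorem exists_matchingVectorCode {t n d : ℕ} {p e : Fin t → ℕ} (hp : ∀ i, (p i).Prime)
    (hinj : Function.Injective p) (hprod : n < ∏ i, p i ^ e i) (hd : ∀ i, p i ^ e i ≤ d + 1) :
    ∃ (F : Type) (_ : Fintype F) (_ : Nontrivial F), Nonempty (QueryCode (2 ^ n) (2 ^ t)
      (∀ i, {J : Finset (Fin n × Bool) // J.card ≤ d} → ZMod (p i)) F) := by
  classical
  obtain ⟨l, hl, γ, hγ⟩ := exists_field_with_roots hp
  have : Fact l.Prime := ⟨hl⟩
  have hpf : ∀ i, Fact (p i).Prime := fun i ↦ ⟨hp i⟩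
  have hpz : ∀ i, NeZero (p i) := fun i ↦ ⟨(hp i).ne_zero⟩
  let eA : Fin (2 ^ n) ≃ (Fin n → Bool) := (Fintype.equivFinOfCardEq (by simp)).symm
  let eT : Fin (2 ^ t) ≃ Finset (Fin t) := (Fintype.equivFinOfCardEq (by simp)).symm
  let f : ∀ i, ℕ → ZMod (p i) := fun i g ↦ if g ≡ n [MOD p i ^ e i] then 0 else 1
  have hf : ∀ i y, f i (y + p i ^ e i) = f i y := by
    intro i y
    simp only [f]
    congr 1
    simp [Nat.ModEq]
  let ψ : ∀ i, AddChar (ZMod (p i)) (ZMod l) := fun i ↦ AddChar.zmodChar (p i) (hγ i).1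
  have hψ : ∀ i, ψ i 1 = γ i := fun i ↦ by
    simpa using AddChar.zmodChar_apply' (hγ i).1 1
  let Idx := {J : Finset (Fin n × Bool) // J.card ≤ d}
  let br : ∀ i, (Fin n → Bool) → (Idx → ZMod (p i)) → ZMod (p i) := fun i a w ↦
    ∑ J : Idx, if J.1 ⊆ graphSet a then w J else 0
  have hbr : ∀ i a w w', br i a (w + w') = br i a w + br i a w' := by
    intro i a w w'
    simp only [br, ← Finset.sum_add_distrib]
    refine Finset.sum_congr rfl fun J _ ↦ ?_
    split_ifs <;> simp
  have hbr0 : ∀ i a, br i a 0 = 0 := fun i a ↦ by simp [br]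
  let v : (Fin n → Bool) → ∀ i, Idx → ZMod (p i) := fun a i J ↦
    if J.1 ⊆ graphSet a then (fwdDiff 1)^[J.1.card] (f i) 0 else 0
  have hv : ∀ i a b, br i b (v a i) = f i (graphSet a ∩ graphSet b).card := by
    intro i a b
    rw [← sum_subsets_fwdDiff (hf i) (hd i)]
    refine Finset.sum_congr rfl fun J _ ↦ ?_
    simp only [v, Finset.subset_inter_iff]
    split_ifs <;> tauto
  let χ : (Fin n → Bool) → (∀ i, Idx → ZMod (p i)) → ZMod l := fun a w ↦ ∏ i, ψ i (br i a (w i))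
  let shift : (Fin n → Bool) → Finset (Fin t) → ∀ i, Idx → ZMod (p i) := fun a T i ↦
    if i ∈ T then v a i else 0
  have hχ : ∀ a b w, ∑ T : Finset (Fin t), (∏ i ∈ Finset.univ \ T, -γ i) * χ b (w + shift a T) =
      if b = a then χ a w * ∏ i, (1 - γ i) else 0 := by
    intro a b w
    have h1 : ∀ T, χ b (w + shift a T) =
        χ b w * ∏ i ∈ T, ψ i (f i (graphSet a ∩ graphSet b).card) := by
      intro T
      simp only [χ, Pi.add_apply, hbr, AddChar.map_add_eq_mul, Finset.prod_mul_distrib]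
      congr 1
      rw [← Finset.prod_subset (Finset.subset_univ T)]
      · refine Finset.prod_congr rfl fun i hi ↦ ?_
        simp only [shift, if_pos hi, hv]
      · intro i _ hi
        simp only [shift, if_neg hi, hbr0, AddChar.map_zero_eq_one]
    have h2 : ∑ T : Finset (Fin t), (∏ i ∈ Finset.univ \ T, -γ i) * χ b (w + shift a T) =
        χ b w * ∏ i, (ψ i (f i (graphSet a ∩ graphSet b).card) + -γ i) := by
      rw [Finset.prod_add, Finset.powerset_univ, Finset.mul_sum]
      refine Finset.sum_congr rfl fun T _ ↦ ?_
      rw [h1]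
      ring
    rw [h2]
    split_ifs with hab
    · subst hab
      rw [Finset.inter_self, card_graphSet]
      congr 1
      refine Finset.prod_congr rfl fun i _ ↦ ?_
      simp only [f, if_pos (Nat.ModEq.refl n), AddChar.map_zero_eq_one, sub_eq_add_neg]
    · -- The intersection has fewer than `n` elements, so that some congruence fails.
      obtain ⟨i, hi⟩ : ∃ i, ¬ (graphSet a ∩ graphSet b).card ≡ n [MOD p i ^ e i] := by
        by_contra! hall
        have hle : (graphSet a ∩ graphSet b).card ≤ n :=
          (Finset.card_le_card Finset.inter_subset_left).trans (card_graphSet a).le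
        have hdvd : ∏ i, p i ^ e i ∣ n - (graphSet a ∩ graphSet b).card := by
          refine Finset.prod_dvd_of_isRelPrime (fun i _ j _ hij ↦ ?_) fun i _ ↦
            (Nat.modEq_iff_dvd' hle).1 (hall i)
          exact Nat.coprime_iff_isRelPrime.1 (Nat.Coprime.pow _ _
            ((Nat.coprime_primes (hp i) (hp j)).2 (hinj.ne hij)))
        have := Nat.eq_zero_of_dvd_of_lt hdvd ((Nat.sub_le _ _).trans_lt hprod)
        exact hab (eq_of_card_graphSet_inter (by omega)).symm
      rw [Finset.prod_eq_zero (Finset.mem_univ i), mul_zero]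
      simp only [f, if_neg hi, hψ, add_neg_cancel]
  have hχ0 : ∀ a w, χ a w ≠ 0 := fun a w ↦
    Finset.prod_ne_zero_iff.2 fun i _ ↦ (AddChar.val_isUnit _ _).ne_zero
  have hγ1 : ∏ i, (1 - γ i) ≠ 0 :=
    Finset.prod_ne_zero_iff.2 fun i _ ↦ sub_ne_zero.2 (hγ i).2.symm
  -- The symbol at `w` is `∑ b, m b * χ b w`.
  refine ⟨ZMod l, inferInstance, inferInstance, ⟨{
    enc := fun w m ↦ ∑ b, m b * χ (eA b) w
    query := fun a j ↦ shift (eA a) (eT j)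
    decode := fun a w m m' h ↦ ?_ }⟩⟩
  have hdec : ∀ m : Fin (2 ^ n) → ZMod l,
      ∑ T : Finset (Fin t), (∏ i ∈ Finset.univ \ T, -γ i) *
        ∑ b, m b * χ (eA b) (w + shift (eA a) T) = m a * (χ (eA a) w * ∏ i, (1 - γ i)) := by
    intro m
    simp_rw [Finset.mul_sum]
    rw [Finset.sum_comm]
    simp_rw [mul_left_comm _ (m _), ← Finset.mul_sum, hχ]
    simp
  have heq : m a * (χ (eA a) w * ∏ i, (1 - γ i)) = m' a * (χ (eA a) w * ∏ i, (1 - γ i)) := by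
    rw [← hdec, ← hdec]
    refine Finset.sum_congr rfl fun T _ ↦ ?_
    have := h (eT.symm T)
    rw [Equiv.apply_symm_apply] at this
    rw [this]
  exact mul_right_cancel₀ (mul_ne_zero (hχ0 _ _) hγ1) heq

end MatchingVectors

/-- There are `t` primes of size `O(t log t)`, because `2 ^ N / (N + 1)` is a lower bound for the
least common multiple of `1, …, N`. -/
lemma exists_primes {t : ℕ} (ht : 0 < t) : ∃ p : Fin t → ℕ, Function.Injective p ∧
    ∀ i, (p i).Prime ∧ p i ≤ 4 * t * (Nat.clog 2 t + 2) := by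
  set c := Nat.clog 2 t + 2 with hc
  set P := 4 * t * c with hP
  have hcard : t ≤ (Nat.primesLE P).card := by
    by_contra! hlt
    have hPpos : 0 < P := by positivity
    have h1 : Nat.lcmUpto P ≤ P ^ (t - 1) := by
      rw [Nat.lcmUpto_eq_prod_pow_log]
      calc ∏ p ∈ Nat.primesLE P, p ^ p.log P ≤ ∏ p ∈ Nat.primesLE P, P :=
            Finset.prod_le_prod' fun p _ ↦ Nat.pow_log_le_self p hPpos.ne'
        _ = P ^ (Nat.primesLE P).card := by simp
        _ ≤ P ^ (t - 1) := Nat.pow_le_pow_right hPpos (by omega)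
    have h2 : P ≤ 2 ^ (2 * c) := by
      have h3 : t ≤ 2 ^ Nat.clog 2 t := Nat.le_pow_clog one_lt_two t
      have h4 : c ≤ 2 ^ c := Nat.lt_two_pow_self.le
      calc P ≤ 4 * 2 ^ Nat.clog 2 t * 2 ^ c := by rw [hP]; gcongr
        _ = 2 ^ (2 * c) := by rw [hc]; ring
    have h5 : 2 ^ P ≤ 2 ^ (1 + 2 * c * t) := by
      calc 2 ^ P ≤ (P + 1) * Nat.lcmUpto P := Chebyshev.two_pow_le_mul_lcmUpto P
        _ ≤ (2 * P) * P ^ (t - 1) := by gcongr; omega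
        _ = 2 * P ^ t := by rw [mul_assoc, ← pow_succ', Nat.sub_add_cancel ht]
        _ ≤ 2 * (2 ^ (2 * c)) ^ t := by gcongr
        _ = 2 ^ (1 + 2 * c * t) := by rw [← pow_mul, pow_add, pow_one]
    have h6 : P ≤ 1 + 2 * c * t := (Nat.pow_le_pow_iff_right one_lt_two).1 h5
    have h7 : P = 2 * c * t + 2 * c * t := by rw [hP]; ring
    have h8 : 1 * 1 ≤ c * t := Nat.mul_le_mul (by omega) ht
    have h9 : 2 * c * t = 2 * (c * t) := by ring
    omega
  refine ⟨Finset.orderEmbOfCardLe _ hcard, (Finset.orderEmbOfCardLe _ hcard).injective, fun i ↦ ?_⟩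
  have := Nat.mem_primesLE.1 (Finset.orderEmbOfCardLe_mem _ hcard i)
  exact ⟨this.2, this.1⟩

/-! ### Hadamard codes, choice of parameters -/

/-- The code with one symbol for each linear combination of the messages over `ZMod 2`; a message
is the sum of two symbols. -/
def hadamardCode (k : ℕ) : QueryCode k 2 (Fin k → ZMod 2) (ZMod 2) where
  enc w m := ∑ i, w i * m i
  query i j := if j = 0 then 0 else Pi.single i 1
  decode i w m m' h := by
    have h0 := h 0
    have h1 := h 1
    simp only [if_pos, one_ne_zero, if_false, Pi.add_apply, Pi.zero_apply, add_zero, add_mul,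
      Finset.sum_add_distrib] at h0 h1
    rw [h0] at h1
    have h2 := add_left_cancel h1
    simpa [Pi.single_apply] using h2

theorem exists_logGap : ∃ c : ℝ, 0 < c ∧ ∃ k₀ : ℕ, ∀ k : ℕ, k₀ ≤ k →
    ∃ (n : ℕ) (I : MulticastInstance (Fin n) k), I.IsUnitInstance ∧
      ENNReal.ofReal (c * Real.log k) ≤ I.codingGap := by
  refine ⟨1 / 200, by norm_num, 6 ^ 3, fun k hk ↦ ?_⟩
  have hk0 : k ≠ 0 := by positivity
  have hlog : 3 ≤ Nat.log 6 k := Nat.le_log_of_pow_le (by norm_num) hk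
  set ρ := (Nat.log 6 k - 1) / 2 with hρ
  obtain ⟨I, hI, hgap⟩ := exists_instance_of_queryCode (hadamardCode k) (by positivity) two_pos
    (ρ := ρ) ((Nat.pow_le_pow_right (by norm_num) (by omega)).trans (Nat.pow_log_le_self 6 hk0))
    le_rfl
  refine ⟨_, I, hI, (ENNReal.ofReal_le_ofReal ?_).trans hgap⟩
  have h1 : Real.log k ≤ (2 * ρ + 3) * Real.log 6 := by
    have h2 : (k : ℝ) ≤ 6 ^ (2 * ρ + 3) := by
      have h3 : k < 6 ^ (Nat.log 6 k + 1) := Nat.lt_pow_succ_log_self (by norm_num) k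
      exact_mod_cast h3.le.trans (Nat.pow_le_pow_right (by norm_num) (by omega))
    have := Real.log_le_log (by positivity) h2
    rw [Real.log_pow] at this
    exact_mod_cast this
  have h6 : Real.log 6 ≤ 5 := by
    have := Real.log_le_sub_one_of_pos (show (0 : ℝ) < 6 by norm_num)
    linarith
  have hρ1 : (1 : ℝ) ≤ ρ := by exact_mod_cast (show 1 ≤ ρ by omega)
  have h7 : Real.log k ≤ 25 * ρ := by nlinarith
  push_cast
  linarith

lemma card_small_subsets_le (U : Type) [Fintype U] [DecidableEq U] (d : ℕ) :
    Fintype.card {J : Finset U // J.card ≤ d} ≤ (Fintype.card U + 1) ^ d := by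
  let F : (Fin d → Option U) → {J : Finset U // J.card ≤ d} := fun g ↦
    ⟨(Finset.univ.image g).eraseNone, (Finset.card_eraseNone_le _).trans
      (Finset.card_image_le.trans (by simp))⟩
  have hF : Function.Surjective F := by
    rintro ⟨J, hJ⟩
    refine ⟨fun j ↦ if h : j.val < J.card then some (J.equivFin.symm ⟨j, h⟩).1 else none, ?_⟩
    refine Subtype.ext (Finset.ext fun u ↦ ?_)
    simp only [F, Finset.mem_eraseNone, Finset.mem_image, Finset.mem_univ, true_and]
    constructor
    · rintro ⟨j, hj⟩
      split_ifs at hj with h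
      rw [← Option.some.inj hj]
      exact (J.equivFin.symm ⟨j, h⟩).2
    · intro hu
      refine ⟨⟨J.equivFin ⟨u, hu⟩, (J.equivFin ⟨u, hu⟩).2.trans_le hJ⟩, ?_⟩
      simp
  simpa using Fintype.card_le_of_surjective F hF

/-- With `t` primes, the matching vector code with `256 ^ t` message bits yields coding gap `2 ^ t`
on graphs of doubly exponential size in `t ^ 2 log t`. -/
theorem exists_instance_two_pow {t : ℕ} (ht : 0 < t) {n : ℕ}
    (hn : 2 ^ 2 ^ (10243 * (t ^ 2 * (Nat.clog 2 t + 2))) ≤ n) :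
    ∃ (k : ℕ) (I : MulticastInstance (Fin n) k), I.IsUnitInstance ∧
      ENNReal.ofReal (2 ^ t) ≤ I.codingGap := by
  classical
  obtain ⟨p, hinj, hp⟩ := exists_primes ht
  set c := Nat.clog 2 t + 2 with hc
  set P := 4 * t * c with hP
  set s := t ^ 2 * c with hs
  have hts : t ≤ s := by
    calc t = t * 1 * 1 := by ring
      _ ≤ t * t * c := by gcongr <;> omega
      _ = s := by rw [hs]; ring
  have htc : t * c ≤ s := by
    calc t * c = t * 1 * c := by ring
      _ ≤ t * t * c := by gcongr; omega
      _ = s := by rw [hs]; ring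
  let e : Fin t → ℕ := fun i ↦ Nat.clog (p i) 257
  have he : ∀ i, 257 ≤ p i ^ e i := fun i ↦ Nat.le_pow_clog (hp i).1.one_lt _
  have he' : ∀ i, p i ^ e i ≤ 256 * P + 1 := by
    intro i
    have h1 : p i ^ (e i - 1) < 257 := Nat.pow_pred_clog_lt_self (hp i).1.one_lt (by norm_num)
    have h2 : 0 < e i := Nat.clog_pos (hp i).1.one_lt (by norm_num)
    calc p i ^ e i = p i ^ (e i - 1) * p i := by rw [← pow_succ, Nat.sub_add_cancel h2]
      _ ≤ 256 * P := by
          gcongr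
          · omega
          · exact (hp i).2
      _ ≤ _ := Nat.le_succ _
  have hprod : 256 ^ t < ∏ i, p i ^ e i := by
    calc 256 ^ t < 257 ^ t := Nat.pow_lt_pow_left (by norm_num) ht.ne'
      _ = ∏ _i : Fin t, 257 := by simp
      _ ≤ _ := Finset.prod_le_prod' fun i _ ↦ he i
  have hpz : ∀ i, NeZero (p i) := fun i ↦ ⟨(hp i).1.ne_zero⟩
  obtain ⟨F, _, _, ⟨C⟩⟩ := exists_matchingVectorCode (fun i ↦ (hp i).1) hinj hprod he'
  have hquery : 2 ^ t + 4 ≤ 2 ^ (t + 3) := by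
    have := Nat.one_le_two_pow (n := t)
    calc 2 ^ t + 4 ≤ 2 ^ t + 4 * 2 ^ t := by omega
      _ ≤ 2 ^ t * 8 := by omega
      _ = _ := by rw [pow_add]; norm_num
  have hρ : (2 ^ t + 4) ^ (2 * 4 ^ (t + 1) + 1) ≤ 2 ^ 256 ^ t := by
    have h1 : ∀ r, 0 < r → r + 3 ≤ 4 ^ r := by
      intro r hr
      induction r, hr using Nat.le_induction with
      | base => norm_num
      | succ r _ ih => rw [pow_succ]; omega
    have h2 : 2 * 4 ^ (t + 1) + 1 ≤ 16 * 4 ^ t := by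
      have := Nat.one_le_pow t 4 (by norm_num)
      rw [pow_succ]
      omega
    calc (2 ^ t + 4) ^ (2 * 4 ^ (t + 1) + 1) ≤ (2 ^ (t + 3)) ^ (2 * 4 ^ (t + 1) + 1) := by gcongr
      _ = 2 ^ ((t + 3) * (2 * 4 ^ (t + 1) + 1)) := by rw [← pow_mul]
      _ ≤ 2 ^ (4 ^ t * (16 ^ t * 4 ^ t)) := by
          refine Nat.pow_le_pow_right two_pos (Nat.mul_le_mul (h1 t ht) (h2.trans ?_))
          gcongr
          exact Nat.le_self_pow ht.ne' 16
      _ = 2 ^ 256 ^ t := by rw [← mul_pow, ← mul_pow]; norm_num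
  have hW : Fintype.card (∀ i, {J : Finset (Fin (256 ^ t) × Bool) // J.card ≤ 256 * P} →
      ZMod (p i)) ≤ 2 ^ 2 ^ (10241 * s) := by
    set H := Fintype.card {J : Finset (Fin (256 ^ t) × Bool) // J.card ≤ 256 * P} with hH
    have hHle : H ≤ 2 ^ (10240 * s) := by
      have h1 : 256 ^ t * 2 + 1 ≤ 2 ^ (10 * t) := by
        have h2 : 1 ≤ 256 ^ t := Nat.one_le_pow _ _ (by norm_num)
        have h3 : 4 ≤ 4 ^ t := Nat.le_self_pow ht.ne' 4
        calc 256 ^ t * 2 + 1 ≤ 256 ^ t * 4 := by omega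
          _ ≤ 256 ^ t * 4 ^ t := by gcongr
          _ = 2 ^ (10 * t) := by rw [← mul_pow, pow_mul]; norm_num
      calc H ≤ (Fintype.card (Fin (256 ^ t) × Bool) + 1) ^ (256 * P) := card_small_subsets_le _ _
        _ = (256 ^ t * 2 + 1) ^ (256 * P) := by simp
        _ ≤ (2 ^ (10 * t)) ^ (256 * P) := by gcongr
        _ = 2 ^ (10240 * s) := by rw [← pow_mul, hP, hs]; congr 1; ring
    have hPle : P ≤ 2 ^ (2 * c) := by
      have h3 : t ≤ 2 ^ Nat.clog 2 t := Nat.le_pow_clog one_lt_two t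
      have h4 : c ≤ 2 ^ c := Nat.lt_two_pow_self.le
      calc P ≤ 4 * 2 ^ Nat.clog 2 t * 2 ^ c := by rw [hP]; gcongr
        _ = 2 ^ (2 * c) := by rw [hc]; ring
    have h2s : 2 * s ≤ 2 ^ s := by
      obtain ⟨r, hr⟩ := Nat.exists_eq_succ_of_ne_zero (show s ≠ 0 by omega)
      have := Nat.lt_two_pow_self (n := r)
      rw [hr, Nat.succ_eq_add_one, pow_succ]
      omega
    calc Fintype.card (∀ i, {J : Finset (Fin (256 ^ t) × Bool) // J.card ≤ 256 * P} →
          ZMod (p i)) = ∏ i, p i ^ H := by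
          rw [Fintype.card_pi]
          exact Finset.prod_congr rfl fun i _ ↦ by rw [Fintype.card_fun, ZMod.card]
      _ ≤ ∏ _i : Fin t, P ^ H := Finset.prod_le_prod' fun i _ ↦ Nat.pow_le_pow_left (hp i).2 H
      _ = (P ^ H) ^ t := by simp
      _ ≤ ((2 ^ (2 * c)) ^ H) ^ t := by gcongr
      _ = 2 ^ (2 * (t * c) * H) := by rw [← pow_mul, ← pow_mul]; congr 1; ring
      _ ≤ 2 ^ (2 ^ s * 2 ^ (10240 * s)) := by
          refine Nat.pow_le_pow_right two_pos (Nat.mul_le_mul (le_trans ?_ h2s) hHle)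
          omega
      _ = 2 ^ 2 ^ (10241 * s) := by rw [← pow_add]; congr 2; ring
  have hsize : Fintype.card (∀ i, {J : Finset (Fin (256 ^ t) × Bool) // J.card ≤ 256 * P} →
      ZMod (p i)) * (2 ^ 256 ^ t * (2 ^ t + 4)) ≤ n := by
    refine le_trans ?_ hn
    have h1 : 256 ^ t ≤ 2 ^ (10241 * s) := by
      rw [show 256 = 2 ^ 8 by norm_num, ← pow_mul]
      exact Nat.pow_le_pow_right two_pos (by omega)
    have h2 : t + 3 ≤ 2 ^ (10241 * s) :=
      Nat.lt_two_pow_self.le.trans (Nat.pow_le_pow_right two_pos (by omega))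
    calc _ ≤ 2 ^ 2 ^ (10241 * s) * (2 ^ 256 ^ t * 2 ^ (t + 3)) := by gcongr
      _ = 2 ^ (2 ^ (10241 * s) + (256 ^ t + (t + 3))) := by rw [← pow_add, ← pow_add]
      _ ≤ 2 ^ (2 ^ (10241 * s) * 2 ^ (2 * s)) := by
          refine Nat.pow_le_pow_right two_pos ?_
          have h4 : 2 ^ 2 ≤ 2 ^ (2 * s) := Nat.pow_le_pow_right two_pos (by omega)
          have := Nat.mul_le_mul_left (2 ^ (10241 * s)) h4
          omega
      _ = 2 ^ 2 ^ (10243 * s) := by rw [← pow_add]; congr 2; ring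
  obtain ⟨I, hI, hgap⟩ := exists_instance_of_queryCode C (by positivity) (by positivity) hρ hsize
  refine ⟨_, I, hI, (ENNReal.ofReal_le_ofReal (le_of_eq ?_)).trans hgap⟩
  push_cast
  rw [pow_succ, show (4 : ℝ) ^ t = 2 ^ t * 2 ^ t by rw [← mul_pow]; norm_num]
  field_simp

/-- The parameter `t = ⌊ε √(ℓ / log ℓ)⌋`, for `ℓ = log log n`, satisfies the size condition of
`exists_instance_two_pow`, because `log t ≤ log ℓ / 2` and hence `t ^ 2 log t = O(ε ^ 2 ℓ)`. -/
lemma two_pow_two_pow_floor_le {n : ℕ} {ε : ℝ} (hε : 0 < ε) (hε1 : 4 * 10243 * ε ^ 2 ≤ 1)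
    (hn : 1 < Real.log n) (hl : 1 ≤ Real.log (Real.log (Real.log n)))
    (ht : 1 ≤ ⌊ε * √(Real.log (Real.log n) / Real.log (Real.log (Real.log n)))⌋₊) :
    2 ^ 2 ^ (10243 * (⌊ε * √(Real.log (Real.log n) / Real.log (Real.log (Real.log n)))⌋₊ ^ 2 *
      (Nat.clog 2 ⌊ε * √(Real.log (Real.log n) / Real.log (Real.log (Real.log n)))⌋₊ + 2))) ≤ n := by
  set l := Real.log (Real.log n) with hl'
  set y := l / Real.log l with hy
  set t := ⌊ε * √y⌋₊ with ht'
  have hl0 : 0 < l := Real.log_pos hn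
  have hy0 : 0 ≤ y := by positivity
  have hyl : y ≤ l := div_le_self hl0.le hl
  have htpos : (1 : ℝ) ≤ t := by exact_mod_cast ht
  have hty : (t : ℝ) ≤ ε * √y := Nat.floor_le (by positivity)
  have ht2 : (t : ℝ) ^ 2 ≤ ε ^ 2 * y := by
    calc (t : ℝ) ^ 2 ≤ (ε * √y) ^ 2 := by gcongr
      _ = ε ^ 2 * y := by rw [mul_pow, Real.sq_sqrt hy0]
  have hlogt : 2 * Real.log t ≤ Real.log l := by
    have h1 : (t : ℝ) ^ 2 ≤ l := by
      refine ht2.trans (le_trans ?_ hyl)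
      nlinarith
    have := Real.log_le_log (by positivity) h1
    rw [Real.log_pow] at this
    exact_mod_cast this
  have hclog : (Nat.clog 2 t : ℝ) ≤ 1 + 2 * Real.log t := by
    rcases ht.eq_or_lt with h | h
    · rw [← h]
      simp
    · have h1 : 2 ^ (Nat.clog 2 t - 1) < t := Nat.pow_pred_clog_lt_self one_lt_two h
      have h2 : 0 < Nat.clog 2 t := Nat.clog_pos one_lt_two h
      have h3 : ((2 : ℝ) ^ (Nat.clog 2 t - 1)) ≤ t := by exact_mod_cast h1.le
      have h4 := Real.log_le_log (by positivity) h3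
      rw [Real.log_pow, Nat.cast_sub h2] at h4
      have h5 : (1 : ℝ) ≤ Nat.clog 2 t := by exact_mod_cast h2
      have h6 := Real.log_two_gt_d9
      push_cast at h4
      nlinarith
  have hs : ((10243 * (t ^ 2 * (Nat.clog 2 t + 2)) : ℕ) : ℝ) ≤ l := by
    push_cast
    have h1 : (Nat.clog 2 t : ℝ) + 2 ≤ 4 * Real.log l := by linarith
    have h2 : (t : ℝ) ^ 2 * ((Nat.clog 2 t : ℝ) + 2) ≤ ε ^ 2 * y * (4 * Real.log l) := by gcongr
    have h3 : y * Real.log l = l := div_mul_cancel₀ l (by linarith)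
    have h4 : ε ^ 2 * y * (4 * Real.log l) = 4 * ε ^ 2 * l := by
      linear_combination (4 * ε ^ 2) * h3
    nlinarith
  set s := 10243 * (t ^ 2 * (Nat.clog 2 t + 2)) with hs'
  have hn0 : 0 < (n : ℝ) := by
    rcases Nat.eq_zero_or_pos n with h | h
    · rw [h] at hn
      simp at hn
      linarith
    · exact_mod_cast h
  have h2e : (2 : ℝ) ≤ Real.exp 1 := by
    have := Real.add_one_le_exp (1 : ℝ)
    linarith
  have h1 : ((2 ^ s : ℕ) : ℝ) ≤ Real.log n := by
    push_cast
    calc (2 : ℝ) ^ s ≤ Real.exp 1 ^ s := by gcongr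
      _ = Real.exp s := by rw [← Real.exp_nat_mul, mul_one]
      _ ≤ Real.exp l := Real.exp_le_exp.2 hs
      _ = Real.log n := Real.exp_log (by linarith)
  have h2 : ((2 ^ 2 ^ s : ℕ) : ℝ) ≤ n := by
    rw [Nat.cast_pow]
    calc ((2 : ℕ) : ℝ) ^ (2 ^ s) ≤ Real.exp 1 ^ (2 ^ s) := by gcongr; exact_mod_cast h2e
      _ = Real.exp ((2 ^ s : ℕ) : ℝ) := by rw [← Real.exp_nat_mul, mul_one]
      _ ≤ Real.exp (Real.log n) := Real.exp_le_exp.2 h1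
      _ = n := Real.exp_log hn0
  exact_mod_cast h2

open Filter in
theorem exists_vertexGap : ∃ c : ℝ, 0 < c ∧ ∃ n₀ : ℕ, ∀ n : ℕ, n₀ ≤ n →
    ∃ (k : ℕ) (I : MulticastInstance (Fin n) k), I.IsUnitInstance ∧
      ENNReal.ofReal ((2 : ℝ) ^ (c * √(Real.log (Real.log n) /
        Real.log (Real.log (Real.log n))))) ≤ I.codingGap := by
  refine ⟨1 / 406, by norm_num, ?_⟩
  have hlog : Tendsto (fun n : ℕ ↦ Real.log n) atTop atTop :=
    Real.tendsto_log_atTop.comp tendsto_natCast_atTop_atTop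
  have hloglog := Real.tendsto_log_atTop.comp hlog
  have hlogloglog := Real.tendsto_log_atTop.comp hloglog
  have hratio : ∀ᶠ n : ℕ in atTop, ‖Real.log (Real.log (Real.log n))‖ ≤
      (1 / 203 ^ 2) * ‖Real.log (Real.log n)‖ :=
    hloglog.eventually (Real.isLittleO_log_id_atTop.def (by norm_num))
  obtain ⟨n₀, hn₀⟩ := eventually_atTop.1 ((hlog.eventually_gt_atTop 1).and
    ((hlogloglog.eventually_ge_atTop 1).and hratio))
  refine ⟨n₀, fun n hn ↦ ?_⟩
  obtain ⟨h1, h3, h4⟩ := hn₀ n hn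
  simp only [Function.comp_apply] at h3
  have h2 : 0 < Real.log (Real.log n) := Real.log_pos h1
  rw [Real.norm_of_nonneg (by linarith), Real.norm_of_nonneg h2.le] at h4
  have hy : 203 ≤ √(Real.log (Real.log n) / Real.log (Real.log (Real.log n))) := by
    refine Real.le_sqrt_of_sq_le ?_
    rw [le_div_iff₀ (by linarith)]
    linarith
  have ht : 1 ≤ ⌊1 / 203 * √(Real.log (Real.log n) / Real.log (Real.log (Real.log n)))⌋₊ :=
    Nat.le_floor (by push_cast; linarith)
  obtain ⟨k, I, hI, hgap⟩ := exists_instance_two_pow ht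
    (two_pow_two_pow_floor_le (by norm_num) (by norm_num) h1 h3 ht)
  refine ⟨k, I, hI, (ENNReal.ofReal_le_ofReal ?_).trans hgap⟩
  rw [← Real.rpow_natCast]
  refine Real.rpow_le_rpow_of_exponent_le one_le_two ?_
  have h5 := Nat.lt_floor_add_one
    (1 / 203 * √(Real.log (Real.log n) / Real.log (Real.log (Real.log n))))
  have h6 : (1 : ℝ) ≤ ⌊1 / 203 * √(Real.log (Real.log n) / Real.log (Real.log (Real.log n)))⌋₊ := by
    exact_mod_cast ht
  linarith

end NetworkCoding

theorem theorem1 :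
    (∃ c : ℝ, 0 < c ∧ ∃ k₀ : ℕ, ∀ k : ℕ, k₀ ≤ k →
      ∃ (n : ℕ) (I : NetworkCoding.MulticastInstance (Fin n) k), I.IsUnitInstance ∧
        ENNReal.ofReal (c * Real.log k) ≤ I.codingGap) ∧
    (∃ c : ℝ, 0 < c ∧ ∃ n₀ : ℕ, ∀ n : ℕ, n₀ ≤ n →
      ∃ (k : ℕ) (I : NetworkCoding.MulticastInstance (Fin n) k), I.IsUnitInstance ∧
        ENNReal.ofReal ((2 : ℝ) ^ (c * √(Real.log (Real.log n) /
          Real.log (Real.log (Real.log n))))) ≤ I.codingGap) :=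
  ⟨NetworkCoding.exists_logGap, NetworkCoding.exists_vertexGap⟩
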